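/- Let $D>0$, $\mathcal X=[-D,D]^d$, let $\mathcal Y\subset\mathbb R^m$ be non-empty, compact and convex, and let $u,c:\mathcal Y\times\mathcal X\to\mathbb R$ be continuous and convex in their first argument. Let $\gamma>0$, $\lambda_{\max}>0$, $\Lambda=[0,\lambda_{\max}]$, $(y_0,\lambda_0)\in\mathcal Y\times\Lambda$, and $l(y,\lambda,x)=u(y,x)+\lambda\,(c(y,x)-\gamma)$. Experts. Let $(P_h)_{h\ge1}$ be finite measurable partitions of $\mathcal X$, each $P_{h+1}$ refining $P_h$, whose maximal cell diameter tends to $0$ as $h\to\infty$ (such sequences exist), and let $q_h(x)$ be the label of the cell of $P_h$ that contains $x$. For $k,h\ge1$, expert $H_{k,h}$ predicts at round $n$, from the observations $x_1,\dots,x_{n-1}\in\mathcal X$, a pair $(y^n_{k,h},\lambda^n_{k,h})$ as follows. Let $B$ be the set of indices $i$ with $k<i<n$ and $(q_h(x_{i-k}),\dots,q_h(x_{i-1}))=(q_h(x_{n-k}),\dots,q_h(x_{n-1}))$. If $B=\emptyset$ (in particular if $n\le k$), the prediction is $(y_0,\lambda_0)$. Otherwise $$y^n_{k,h}\in\arg\min_{y\in\mathcal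 Y}\max_{\lambda\in\Lambda}F(y,\lambda),\qquad \lambda^n_{k,h}\in\arg\max_{\lambda\in\Lambda}\min_{y\in\mathcal Y}F(y,\lambda),$$ $$F(y,\lambda)=\frac1{|B|}\sum_{i\in B}\Big(l(y,\lambda,x_i)+\big(\|y\|^2-|\lambda|^2\big)\big(\tfrac1n+\tfrac1h+\tfrac1k\big)\Big).$$ For every such sequence of partitions, experts $H_{k,h}$ $(k,h\ge1)$ with these predictions exist, and all of them have the following property. Let $(X_i)_{i\in\mathbb Z}$ be any stationary and ergodic process with $X_i\in\mathcal X$ almost surely, and let $\mathbb P_\infty$ be the regular conditional distribution of $X_0$ given $X_{-1},X_{-2},\dots$. Assume that the process is $\gamma$-feasible: almost surely there is $y'\in\mathcal Y$ with $\mathbb E_{\mathbb P_\infty}[c(y',X_0)]<\gamma$. Assume also that almost surely the dual problem $\max_{\lambda\ge0}\min_{y\in\mathcal Y}\big(\mathbb E_{\mathbb P_\infty}[u(y,X_0)]+\lambda(\mathbb E_{\mathbb P_\infty}[c(y,X_0)]-\gamma)\big)$ has an optimal solution $\lambda^*_\infty<\lambda_{\max}$. Then almost surely the problem of minimizing $\mathbb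 E_{\mathbb P_\infty}[u(y,X_0)]$ over $y\in\mathcal Y$ subject to $\mathbb E_{\mathbb P_\infty}[c(y,X_0)]\le\gamma$ has a solution $y^*_\infty$, its optimal value is integrable, and with $\omega^*=\mathbb E\big[\mathbb E_{\mathbb P_\infty}[u(y^*_\infty,X_0)]\big]$, $$\lim_{k\to\infty}\lim_{h\to\infty}\lim_{N\to\infty}\frac1N\sum_{i=1}^N l(y^i_{k,h},\lambda^i_{k,h},X_i)=\omega^*\quad\text{almost surely,}$$ where $(y^i_{k,h},\lambda^i_{k,h})$ is the prediction of $H_{k,h}$ at round $i$ from $X_1,\dots,X_{i-1}$ and all the limits exist. -/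

import Mathlib

open MeasureTheory ProbabilityTheory Filter Topology

noncomputable section

namespace HistogramExperts

/-- The observation space `[-D, D]^d`, as a subset of Euclidean space. -/
def cube (d : ℕ) (D : ℝ) : Set (EuclideanSpace ℝ (Fin d)) := {x | ∀ i, |x i| ≤ D}

/-- `q 1, q 2, …` label the cells of a refining sequence of finite measurable partitions of `K`
whose mesh tends to `0`: the cells of the `h`-th partition are the sets
`{x ∈ K | q h x = j}`, `j ∈ ℕ`, and `q h` is the corresponding quantizer. -/
structure IsRefiningQuantizer {E : Type*} [PseudoMetricSpace E] [MeasurableSpace E]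
    (K : Set E) (q : ℕ → E → ℕ) : Prop where
  measurable_cell : ∀ h j, MeasurableSet {x ∈ K | q h x = j}
  finite_cells : ∀ h, (q h '' K).Finite
  refines : ∀ h, ∀ x ∈ K, ∀ y ∈ K, q (h + 1) x = q (h + 1) y → q h x = q h y
  mesh : ∀ ε > 0, ∀ᶠ h in atTop, ∀ j, Metric.diam {x ∈ K | q h x = j} ≤ ε

section Game

variable {d m : ℕ}

/-- The instantaneous Lagrangian `u(y,x) + lam (c(y,x) - γ)`. -/
def lagLoss (u c : EuclideanSpace ℝ (Fin m) → EuclideanSpace ℝ (Fin d) → ℝ) (γ : ℝ)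
    (y : EuclideanSpace ℝ (Fin m)) (lam : ℝ) (x : EuclideanSpace ℝ (Fin d)) : ℝ :=
  u y x + lam * (c y x - γ)

/-- The regularized instantaneous Lagrangian used by expert `(k, h)` at round `r`. -/
def regLoss (u c : EuclideanSpace ℝ (Fin m) → EuclideanSpace ℝ (Fin d) → ℝ) (γ : ℝ)
    (k h r : ℕ) (y : EuclideanSpace ℝ (Fin m)) (lam : ℝ) (x : EuclideanSpace ℝ (Fin d)) : ℝ :=
  lagLoss u c γ y lam x
    + (‖y‖ ^ 2 - ‖lam‖ ^ 2) * (1 / (r : ℝ) + 1 / (h : ℝ) + 1 / (k : ℝ))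

/-- Given a history `x 0, …, x (n-1)` and a labelling `q`, the times `i` with `k ≤ i < n` such
that the `k` labels immediately before time `i` are the last `k` labels of the history, that is
`q (x (i-s)) = q (x (n-s))` for `s = 1, …, k` (written with `a = i - s`, `b = n - s`). -/
def matchingTimes {E : Type*} (q : E → ℕ) (k : ℕ) {n : ℕ} (x : Fin n → E) : Finset (Fin n) :=
  Finset.univ.filter fun i => k ≤ (i : ℕ) ∧
    ∀ a b : Fin n, (a : ℕ) < i → (i : ℕ) ≤ a + k → (a : ℕ) + n = b + i → q (x a) = q (x b)

/-- The average of the regularized Lagrangian over the matching observations of the history.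
After `n` observations the current round is `n + 1`. -/
def empLoss (u c : EuclideanSpace ℝ (Fin m) → EuclideanSpace ℝ (Fin d) → ℝ) (γ : ℝ)
    (q : ℕ → EuclideanSpace ℝ (Fin d) → ℕ) (k h : ℕ) {n : ℕ}
    (x : Fin n → EuclideanSpace ℝ (Fin d)) (y : EuclideanSpace ℝ (Fin m)) (lam : ℝ) : ℝ :=
  ((matchingTimes (q h) k x).card : ℝ)⁻¹ *
    ∑ i ∈ matchingTimes (q h) k x, regLoss u c γ k h (n + 1) y lam (x i)

/-- `p.1 ∈ argmin_{y ∈ Y} max_{lam ∈ Λ} F y lam` and `p.2 ∈ argmax_{lam ∈ Λ} min_{y ∈ Y} F y lam`. -/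
def IsMinimaxPair {V : Type*} (Y : Set V) (Λ : Set ℝ) (F : V → ℝ → ℝ) (p : V × ℝ) : Prop :=
  (p.1 ∈ Y ∧ IsMinOn (fun y => ⨆ lam : Λ, F y lam) Y p.1) ∧
  (p.2 ∈ Λ ∧ IsMaxOn (fun lam => ⨅ y : Y, F y lam) Λ p.2)

/-- An expert: `G n x` is the pair predicted at round `n + 1` from the `n` past observations `x`.
It is the histogram expert with context length `k` and quantization level `h` if on every history
in the observation space it plays the minimax pair of the empirical regularized Lagrangian over
the matching observations, and the default pair `(y₀, lam₀)` if nothing matches. -/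
def IsHistogramExpert (D : ℝ) (Y : Set (EuclideanSpace ℝ (Fin m)))
    (u c : EuclideanSpace ℝ (Fin m) → EuclideanSpace ℝ (Fin d) → ℝ) (γ lamMax : ℝ)
    (y₀ : EuclideanSpace ℝ (Fin m)) (lam₀ : ℝ)
    (q : ℕ → EuclideanSpace ℝ (Fin d) → ℕ) (k h : ℕ)
    (G : (n : ℕ) → (Fin n → EuclideanSpace ℝ (Fin d)) → EuclideanSpace ℝ (Fin m) × ℝ) : Prop :=
  ∀ (n : ℕ) (x : Fin n → EuclideanSpace ℝ (Fin d)), (∀ i, x i ∈ cube d D) →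
    (matchingTimes (q h) k x = ∅ → G n x = (y₀, lam₀)) ∧
    (matchingTimes (q h) k x ≠ ∅ →
      IsMinimaxPair Y (Set.Icc 0 lamMax) (empLoss u c γ q k h x) (G n x))

/-- Average Lagrangian loss of an expert over the rounds `1, …, N` on the outcomes `x 1, x 2, …`. -/
def avgLoss (u c : EuclideanSpace ℝ (Fin m) → EuclideanSpace ℝ (Fin d) → ℝ) (γ : ℝ)
    (G : (n : ℕ) → (Fin n → EuclideanSpace ℝ (Fin d)) → EuclideanSpace ℝ (Fin m) × ℝ)
    (x : ℤ → EuclideanSpace ℝ (Fin d)) (N : ℕ) : ℝ :=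
  (1 / (N : ℝ)) * ∑ n ∈ Finset.range N,
    lagLoss u c γ (G n fun j => x ((j : ℕ) + 1)).1 (G n fun j => x ((j : ℕ) + 1)).2 (x (n + 1))

/-- The decisions in `Y` that satisfy the constraint in expectation under `P`. -/
def feasibleSet (Y : Set (EuclideanSpace ℝ (Fin m)))
    (c : EuclideanSpace ℝ (Fin m) → EuclideanSpace ℝ (Fin d) → ℝ) (γ : ℝ)
    (P : Measure (EuclideanSpace ℝ (Fin d))) : Set (EuclideanSpace ℝ (Fin m)) :=
  {y ∈ Y | ∫ x, c y x ∂P ≤ γ}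

/-- `y` solves: minimize `E_P[u(y, ·)]` over `y ∈ Y` subject to `E_P[c(y, ·)] ≤ γ`. -/
def IsSolution (Y : Set (EuclideanSpace ℝ (Fin m)))
    (u c : EuclideanSpace ℝ (Fin m) → EuclideanSpace ℝ (Fin d) → ℝ) (γ : ℝ)
    (P : Measure (EuclideanSpace ℝ (Fin d))) (y : EuclideanSpace ℝ (Fin m)) : Prop :=
  y ∈ feasibleSet Y c γ P ∧ IsMinOn (fun z => ∫ x, u z x ∂P) (feasibleSet Y c γ P) y

/-- The optimal value of that minimization problem. -/
def optValue (Y : Set (EuclideanSpace ℝ (Fin m)))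
    (u c : EuclideanSpace ℝ (Fin m) → EuclideanSpace ℝ (Fin d) → ℝ) (γ : ℝ)
    (P : Measure (EuclideanSpace ℝ (Fin d))) : ℝ :=
  sInf ((fun y => ∫ x, u y x ∂P) '' feasibleSet Y c γ P)

/-- `lam ≥ 0` is an optimal dual variable of that minimization problem: it maximizes over
`[0, ∞)` the dual function `min_{y ∈ Y} E_P[u(y, ·)] + lam (E_P[c(y, ·)] - γ)`. -/
def IsDualOptimal (Y : Set (EuclideanSpace ℝ (Fin m)))
    (u c : EuclideanSpace ℝ (Fin m) → EuclideanSpace ℝ (Fin d) → ℝ) (γ : ℝ)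
    (P : Measure (EuclideanSpace ℝ (Fin d))) (lam : ℝ) : Prop :=
  0 ≤ lam ∧
    IsMaxOn (fun l : ℝ => ⨅ y : Y, ((∫ x, u y x ∂P) + l * ((∫ x, c y x ∂P) - γ))) (Set.Ici 0) lam

end Game

section StochProc

variable {d m : ℕ} {Ω : Type*} [MeasurableSpace Ω]

/-- A two-sided process is stationary and ergodic: the left shift on path space preserves the law
of the process and is ergodic for it. -/
structure IsStationaryErgodic (μ : Measure Ω) (X : ℤ → Ω → EuclideanSpace ℝ (Fin d)) : Prop where
  measurable : ∀ i, Measurable (X i)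
  ergodic : Ergodic (fun (x : ℤ → EuclideanSpace ℝ (Fin d)) (i : ℤ) => x (i + 1))
    (μ.map fun ω i => X i ω)

/-- The infinite past `(X₋₁, X₋₂, …)`. -/
def past (X : ℤ → Ω → EuclideanSpace ℝ (Fin d)) (ω : Ω) : ℕ → EuclideanSpace ℝ (Fin d) :=
  fun j => X (-((j : ℤ) + 1)) ω

/-- The regular conditional distribution of `X₀` given the infinite past. -/
def condPast (μ : Measure Ω) [IsFiniteMeasure μ] (X : ℤ → Ω → EuclideanSpace ℝ (Fin d)) (ω : Ω) :
    Measure (EuclideanSpace ℝ (Fin d)) :=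
  condDistrib (X 0) (past X) μ (past X ω)

/-- A stationary ergodic process with values in the cube is `γ`-feasible: almost surely some
decision in `Y` satisfies the constraint strictly under the conditional law of `X₀` given the
infinite past. -/
structure IsFeasibleProcess (D : ℝ) (Y : Set (EuclideanSpace ℝ (Fin m)))
    (c : EuclideanSpace ℝ (Fin m) → EuclideanSpace ℝ (Fin d) → ℝ) (γ : ℝ)
    (μ : Measure Ω) [IsFiniteMeasure μ] (X : ℤ → Ω → EuclideanSpace ℝ (Fin d)) : Prop where
  stationaryErgodic : IsStationaryErgodic μ X
  mem_cube : ∀ i, ∀ᵐ ω ∂μ, X i ω ∈ cube d D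
  feasible : ∀ᵐ ω ∂μ, ∃ y ∈ Y, ∫ x, c y x ∂(condPast μ X ω) < γ

/-- The `γ`-feasible optimal value: the expectation of the conditional optimal value. -/
def feasibleOptimum (Y : Set (EuclideanSpace ℝ (Fin m)))
    (u c : EuclideanSpace ℝ (Fin m) → EuclideanSpace ℝ (Fin d) → ℝ) (γ : ℝ)
    (μ : Measure Ω) [IsFiniteMeasure μ] (X : ℤ → Ω → EuclideanSpace ℝ (Fin d)) : ℝ :=
  ∫ ω, optValue Y u c γ (condPast μ X ω) ∂μ

end StochProc

end HistogramExperts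

end

open HistogramExperts

/-! Fix `k` and `h`. Only finitely many label contexts of length `k` occur. By Birkhoff's theorem
(`ae_tendsto_birkhoffSum_div`), along the rounds with a given context the empirical objective
converges, uniformly in the decision and the multiplier, to the regularized Lagrangian of the law of
`X 0` conditioned on that context. Its limiting weight `1/h + 1/k` is positive, so the limit is
strongly convex in `y` and strongly concave in `lam`. Its saddle point is then stable under uniform
perturbations (`IsSaddle.dist_sq_le`), and the predictions made in a given context converge to it.
The average loss is therefore asymptotically that of a fixed function of the context, and Birkhoff's
theorem identifies its limit as the mean unregularized Lagrangian at the conditional saddle point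
(`IsHistogramExpert.ae_tendsto_avgLoss`).

As `h → ∞` the quantized contexts generate the σ-algebra of the last `k` observations, and as `k →
∞` these generate that of the whole past. Lévy's upward theorem gives convergence of the conditional
integrals, uniformly on `Y` (`IsIntegrand.ae_tendstoUniformlyOn_condDistrib`). Saddle values, unlike
saddle points, converge even when the limiting weight is zero (`tendsto_saddle_value`), and
dominated convergence passes to expectations. What remains is the mean saddle value of the
conditional Lagrangian on `Y × [0, lamMax]`. A dual optimum below `lamMax` makes this the
constrained optimal value (`exists_solution_of_dual_optimal`). -/

namespace HistogramExperts

/-! ### Saddle points and minimax pairs of an abstract payoff. -/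

section SaddlePoint

variable {V : Type*}

/-- `p` is a saddle point of `F` on `Y × Λ`. -/
def IsSaddle (Y : Set V) (Λ : Set ℝ) (F : V → ℝ → ℝ) (p : V × ℝ) : Prop :=
  p.1 ∈ Y ∧ p.2 ∈ Λ ∧ ∀ y ∈ Y, ∀ lam ∈ Λ, F p.1 lam ≤ F y p.2

/-- Let `t → 0`. Strong convexity estimates end this way: the optimum is compared with a point a
fraction `t` along a segment, and division by `t` leaves a factor `1 - t`. -/
theorem le_of_forall_one_sub_mul_le {a b c : ℝ}
    (h : ∀ t : ℝ, 0 < t → t < 1 → a + (1 - t) * c ≤ b) : a + c ≤ b := by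
  have hT : Tendsto (fun t : ℝ => a + (1 - t) * c) (𝓝[>] 0) (𝓝 (a + (1 - 0) * c)) := by
    have : Continuous fun t : ℝ => a + (1 - t) * c := by fun_prop
    exact this.continuousAt.mono_left nhdsWithin_le_nhds
  have := le_of_tendsto hT (b := b) (by
    filter_upwards [Ioo_mem_nhdsGT (zero_lt_one' ℝ)] with t ht using h t ht.1 ht.2)
  simpa using this

theorem IsSaddle.le_left {Y : Set V} {Λ : Set ℝ} {F : V → ℝ → ℝ} {p : V × ℝ}
    (h : IsSaddle Y Λ F p) {lam : ℝ} (hl : lam ∈ Λ) : F p.1 lam ≤ F p.1 p.2 :=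
  h.2.2 _ h.1 _ hl

theorem IsSaddle.le_right {Y : Set V} {Λ : Set ℝ} {F : V → ℝ → ℝ} {p : V × ℝ}
    (h : IsSaddle Y Λ F p) {y : V} (hy : y ∈ Y) : F p.1 p.2 ≤ F y p.2 :=
  h.2.2 _ hy _ h.2.1

/-- Both values are compared at the mixed points `(p'.1, p.2)` and `(p.1, p'.2)`, where the payoffs
differ by at most `ε`. No convexity enters, so values are stable even where saddle points are not.
-/
theorem IsSaddle.abs_value_sub_le {Y : Set V} {Λ : Set ℝ} {F F' : V → ℝ → ℝ} {p p' : V × ℝ}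
    (h : IsSaddle Y Λ F p) (h' : IsSaddle Y Λ F' p')
    {ε : ℝ} (hε : ∀ y ∈ Y, ∀ lam ∈ Λ, |F y lam - F' y lam| ≤ ε) :
    |F p.1 p.2 - F' p'.1 p'.2| ≤ ε := by
  have h1 := h.le_right h'.1
  have h2 := h.le_left h'.2.1
  have h3 := h'.le_right h.1
  have h4 := h'.le_left h.2.1
  have h5 := abs_le.1 (hε _ h'.1 _ h.2.1)
  have h6 := abs_le.1 (hε _ h.1 _ h'.2.1)
  rw [abs_le]
  constructor <;> linarith

theorem IsSaddle.isMinimaxPair {Y : Set V} {Λ : Set ℝ} {F : V → ℝ → ℝ} {p : V × ℝ}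
    (h : IsSaddle Y Λ F p) (hba : ∀ y ∈ Y, BddAbove (Set.range fun lam : Λ => F y lam))
    (hbb : ∀ lam ∈ Λ, BddBelow (Set.range fun y : Y => F y lam)) : IsMinimaxPair Y Λ F p := by
  have : Nonempty Λ := ⟨⟨p.2, h.2.1⟩⟩
  have : Nonempty Y := ⟨⟨p.1, h.1⟩⟩
  refine ⟨⟨h.1, fun y hy => ?_⟩, ⟨h.2.1, fun l hl => ?_⟩⟩
  · have h1 (l : Λ) : F p.1 l ≤ ⨆ lam : Λ, F y lam :=
      le_ciSup_of_le (hba y hy) ⟨p.2, h.2.1⟩ (h.2.2 y hy l l.2)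
    exact ciSup_le h1
  · have h1 (y : Y) : ⨅ y : Y, F y l ≤ F y p.2 :=
      ciInf_le_of_le (hbb l hl) ⟨p.1, h.1⟩ (h.2.2 y y.2 l hl)
    exact le_ciInf h1

/-- The two components of a minimax pair are optimized separately, and the existence of any saddle
point `q` closes the duality gap between them. Boundedness keeps the real `⨆` and `⨅` from taking
their default value `0`. -/
theorem IsMinimaxPair.isSaddle {Y : Set V} {Λ : Set ℝ} {F : V → ℝ → ℝ} {p q : V × ℝ}
    (h : IsMinimaxPair Y Λ F p) (hq : IsSaddle Y Λ F q)
    (hba : ∀ y ∈ Y, BddAbove (Set.range fun lam : Λ => F y lam))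
    (hbb : ∀ lam ∈ Λ, BddBelow (Set.range fun y : Y => F y lam)) : IsSaddle Y Λ F p := by
  have : Nonempty Λ := ⟨⟨q.2, hq.2.1⟩⟩
  have : Nonempty Y := ⟨⟨q.1, hq.1⟩⟩
  refine ⟨h.1.1, h.2.1, fun y hy l hl => ?_⟩
  have h1 : (⨆ lam : Λ, F p.1 lam) ≤ ⨆ lam : Λ, F q.1 lam := h.1.2 hq.1
  have h2 : (⨅ y : Y, F y q.2) ≤ ⨅ y : Y, F y p.2 := h.2.2 hq.2.1
  calc F p.1 l ≤ ⨆ lam : Λ, F p.1 lam := le_ciSup (hba _ h.1.1) ⟨l, hl⟩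
    _ ≤ ⨆ lam : Λ, F q.1 lam := h1
    _ ≤ F q.1 q.2 := ciSup_le fun l => hq.le_left (Subtype.prop l)
    _ ≤ ⨅ y : Y, F y q.2 := le_ciInf fun y => hq.le_right (Subtype.prop y)
    _ ≤ ⨅ y : Y, F y p.2 := h2
    _ ≤ F y p.2 := ciInf_le (hbb _ h.2.1) ⟨y, hy⟩

end SaddlePoint

/-! ### The quadratically regularized Lagrangian. -/

section Lagrangian

variable {V : Type*} [NormedAddCommGroup V]

/-- The Lagrangian `f + lam g` with the quadratic regularization of weight `ρ`. -/
def saddleFun (f g : V → ℝ) (ρ : ℝ) (y : V) (lam : ℝ) : ℝ :=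
  f y + lam * g y + (‖y‖ ^ 2 - ‖lam‖ ^ 2) * ρ

theorem saddleFun_sub_fst (f g : V → ℝ) (ρ : ℝ) (y : V) (a b : ℝ) :
    saddleFun f g ρ y a - saddleFun f g ρ y b = (a - b) * (g y - (a + b) * ρ) := by
  simp only [saddleFun, Real.norm_eq_abs, sq_abs]; ring

/-- A regularized Lagrangian decays quadratically in the multiplier around its maximizer. -/
theorem saddleFun_quadratic_decay {L : ℝ} {f g : V → ℝ} {ρ : ℝ} {y : V} {p lam : ℝ}
    (hp : p ∈ Set.Icc 0 L) (hlam : lam ∈ Set.Icc 0 L)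
    (hmax : ∀ l ∈ Set.Icc 0 L, saddleFun f g ρ y l ≤ saddleFun f g ρ y p) :
    saddleFun f g ρ y lam + ρ * (lam - p) ^ 2 ≤ saddleFun f g ρ y p := by
  apply le_of_forall_one_sub_mul_le
  intro t ht0 ht1
  -- The maximizer is compared with the point `(1 - t) p + t lam`; dividing by `t` and letting `t →
  -- 0` gives the quadratic term.
  have hz := (convex_Icc 0 L) hp hlam (by linarith : 0 ≤ 1 - t) ht0.le (by ring)
  have h1 := hmax _ hz
  simp only [saddleFun, smul_eq_mul, Real.norm_eq_abs, sq_abs] at h1 ⊢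
  refine le_of_mul_le_mul_left ?_ ht0
  nlinarith

theorem continuousOn_saddleFun {Y : Set V} {f g : V → ℝ} (hf : ContinuousOn f Y)
    (hg : ContinuousOn g Y) :
    ContinuousOn (fun z : V × ℝ × ℝ => saddleFun f g z.2.1 z.1 z.2.2) (Y ×ˢ Set.univ) := by
  have h1 : ContinuousOn (fun z : V × ℝ × ℝ => f z.1) (Y ×ˢ Set.univ) :=
    hf.comp continuousOn_fst fun z hz => hz.1
  have h2 : ContinuousOn (fun z : V × ℝ × ℝ => g z.1) (Y ×ˢ Set.univ) :=
    hg.comp continuousOn_fst fun z hz => hz.1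
  have h3 : ContinuousOn (fun z : V × ℝ × ℝ => z.2.2 * g z.1) (Y ×ˢ Set.univ) :=
    (by fun_prop : Continuous fun z : V × ℝ × ℝ => z.2.2).continuousOn.mul h2
  exact (h1.add h3).add (by fun_prop : Continuous fun z : V × ℝ × ℝ =>
    (‖z.1‖ ^ 2 - ‖z.2.2‖ ^ 2) * z.2.1).continuousOn

theorem bddAbove_range_saddleFun {f g : V → ℝ} {ρ L : ℝ} (y : V) :
    BddAbove (Set.range fun lam : Set.Icc 0 L => saddleFun f g ρ y lam) := by
  have : Continuous fun lam : Set.Icc 0 L => saddleFun f g ρ y lam := by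
    unfold saddleFun; fun_prop
  exact (isCompact_range this).bddAbove

theorem bddBelow_range_saddleFun {Y : Set V} (hY : IsCompact Y) {f g : V → ℝ}
    (hfc : ContinuousOn f Y) (hgc : ContinuousOn g Y) {ρ : ℝ} (lam : ℝ) :
    BddBelow (Set.range fun y : Y => saddleFun f g ρ y lam) := by
  have h := (continuousOn_saddleFun hfc hgc).comp (f := fun y : V => (y, ρ, lam)) (s := Y)
    (by fun_prop) fun z hz => ⟨hz, trivial⟩
  have := (hY.image_of_continuousOn h).bddBelow
  rwa [Set.image_eq_range] at this

end Lagrangian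

/-! ### Strong convexity, the minimax theorem and strong duality. -/

section Minimax

variable {V : Type*} [NormedAddCommGroup V] [InnerProductSpace ℝ V]

theorem norm_sq_convex_combination (x y : V) (t : ℝ) :
    ‖(1 - t) • x + t • y‖ ^ 2 = (1 - t) * ‖x‖ ^ 2 + t * ‖y‖ ^ 2 - t * (1 - t) * ‖y - x‖ ^ 2 := by
  rw [norm_add_sq_real, norm_sub_sq_real, norm_smul, norm_smul, inner_smul_left, inner_smul_right,
    real_inner_comm x y, mul_pow, mul_pow, Real.norm_eq_abs, Real.norm_eq_abs, sq_abs, sq_abs]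
  simp only [conj_trivial]
  ring

/-- A regularized Lagrangian grows quadratically in `y` around its minimizer. -/
theorem saddleFun_quadratic_growth {Y : Set V} {f g : V → ℝ}
    (hf : ConvexOn ℝ Y f) (hg : ConvexOn ℝ Y g) {ρ lam : ℝ} (hlam : 0 ≤ lam) {p : V} (hp : p ∈ Y)
    (hmin : ∀ y ∈ Y, saddleFun f g ρ p lam ≤ saddleFun f g ρ y lam) {y : V} (hy : y ∈ Y) :
    saddleFun f g ρ p lam + ρ * ‖y - p‖ ^ 2 ≤ saddleFun f g ρ y lam := by
  apply le_of_forall_one_sub_mul_le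
  intro t ht0 ht1
  have hz := hf.1 hp hy (by linarith : 0 ≤ 1 - t) ht0.le (by ring)
  have h1 := hmin _ hz
  have h2 := hf.2 hp hy (by linarith : 0 ≤ 1 - t) ht0.le (by ring)
  have h3 := hg.2 hp hy (by linarith : 0 ≤ 1 - t) ht0.le (by ring)
  simp only [saddleFun] at h1 ⊢
  rw [norm_sq_convex_combination] at h1
  simp only [smul_eq_mul] at h2 h3
  have h4 := mul_le_mul_of_nonneg_left h3 hlam
  refine le_of_mul_le_mul_left ?_ ht0
  nlinarith

/-- Growth in `y` and decay in `lam` are added, and the saddle value cancels. The gap between the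
two mixed values thus controls the squared distance to the saddle point. -/
theorem IsSaddle.quadratic_growth {Y : Set V} {L : ℝ} {f g : V → ℝ}
    (hf : ConvexOn ℝ Y f) (hg : ConvexOn ℝ Y g) {ρ : ℝ} {p : V × ℝ}
    (h : IsSaddle Y (Set.Icc 0 L) (saddleFun f g ρ) p) {y : V} (hy : y ∈ Y) {lam : ℝ}
    (hlam : lam ∈ Set.Icc 0 L) :
    saddleFun f g ρ p.1 lam + ρ * (‖y - p.1‖ ^ 2 + (lam - p.2) ^ 2)
      ≤ saddleFun f g ρ y p.2 := by
  have h1 := saddleFun_quadratic_growth hf hg h.2.1.1 h.1 (fun z hz => h.le_right hz) hy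
  have h2 := saddleFun_quadratic_decay h.2.1 hlam (fun z hz => h.le_left hz)
  linarith

/-- Saddle points depend continuously on the regularized Lagrangian. -/
theorem IsSaddle.dist_sq_le {Y : Set V} {L : ℝ} {f g : V → ℝ}
    (hf : ConvexOn ℝ Y f) (hg : ConvexOn ℝ Y g) {ρ : ℝ} {p p' : V × ℝ} {F : V → ℝ → ℝ}
    (h : IsSaddle Y (Set.Icc 0 L) (saddleFun f g ρ) p) (h' : IsSaddle Y (Set.Icc 0 L) F p')
    {ε : ℝ} (hε : ∀ y ∈ Y, ∀ lam ∈ Set.Icc 0 L, |saddleFun f g ρ y lam - F y lam| ≤ ε) :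
    ρ * (‖p'.1 - p.1‖ ^ 2 + (p'.2 - p.2) ^ 2) ≤ 2 * ε := by
  have h1 := h.quadratic_growth hf hg h'.1 h'.2.1
  -- The saddle inequality of `F` bounds the gap between the mixed values. Replacing `F` by the
  -- Lagrangian costs `ε` at each of the two points.
  have h2 := h'.2.2 _ h.1 _ h.2.1
  have h3 := abs_le.1 (hε _ h.1 _ h'.2.1)
  have h4 := abs_le.1 (hε _ h'.1 _ h.2.1)
  linarith

/-- Maximize the dual function at `p`, with `w l` a minimizer in `y` for the multiplier `l`. Moving
from `p` slightly towards `lam`, concavity in the multiplier and maximality of `p` bound the payoff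
at `(w l, lam)` by the dual value at `p`. Since `ρ > 0`, the minimizers `w l` converge to `w p`, and
the bound survives in the limit. -/
theorem exists_isSaddle_of_pos {Y : Set V} (hY : IsCompact Y) (hne : Y.Nonempty) {L : ℝ}
    (hL : 0 ≤ L) {f g : V → ℝ} (hf : ConvexOn ℝ Y f) (hg : ConvexOn ℝ Y g)
    (hfc : ContinuousOn f Y) (hgc : ContinuousOn g Y) {ρ : ℝ} (hρ : 0 < ρ) :
    ∃ p, IsSaddle Y (Set.Icc 0 L) (saddleFun f g ρ) p := by
  have hFc : ContinuousOn (fun z : V × ℝ => saddleFun f g ρ z.1 z.2) (Y ×ˢ Set.univ) :=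
    (continuousOn_saddleFun hfc hgc).comp (f := fun z : V × ℝ => (z.1, ρ, z.2)) (by fun_prop)
      fun z hz => ⟨hz.1, trivial⟩
  have hFy : ∀ l, ContinuousOn (fun y => saddleFun f g ρ y l) Y := fun l =>
    hFc.comp (f := fun y : V => (y, l)) (by fun_prop) fun z hz => ⟨hz, trivial⟩
  have hmin : ∀ l : ℝ, ∃ y ∈ Y, ∀ z ∈ Y, saddleFun f g ρ y l ≤ saddleFun f g ρ z l := fun l =>
    hY.exists_isMinOn hne (hFy l)
  choose w hwY hw using hmin
  obtain ⟨C, hC⟩ := hY.exists_bound_of_continuousOn hgc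
  have hC0 : 0 ≤ C := (norm_nonneg _).trans (hC _ (hwY 0))
  -- By `saddleFun_sub_fst` the slope in the multiplier is `g y - (a + b) ρ`, with `|g y| ≤ C` and
  -- `0 ≤ a + b ≤ 2 L`.
  set K := C + 2 * L * ρ with hK
  have hK0 : 0 ≤ K := by positivity
  have hlip : ∀ y ∈ Y, ∀ a ∈ Set.Icc 0 L, ∀ b ∈ Set.Icc 0 L,
      saddleFun f g ρ y a ≤ saddleFun f g ρ y b + K * |a - b| := by
    intro y hy a ha b hb
    have h1 := saddleFun_sub_fst f g ρ y a b
    have h2 : |g y - (a + b) * ρ| ≤ K := by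
      have h3 := abs_le.1 (hC y hy)
      have h4 : (a + b) * ρ ≤ 2 * L * ρ := by
        apply mul_le_mul_of_nonneg_right _ hρ.le; linarith [ha.2, hb.2]
      have h5 : 0 ≤ (a + b) * ρ := mul_nonneg (add_nonneg ha.1 hb.1) hρ.le
      rw [abs_le]; constructor <;> linarith
    have h3 : (a - b) * (g y - (a + b) * ρ) ≤ K * |a - b| := by
      refine (le_abs_self _).trans ?_
      rw [abs_mul, mul_comm]
      exact mul_le_mul_of_nonneg_right h2 (abs_nonneg _)
    linarith
  -- A minimum of functions with a common Lipschitz constant is Lipschitz.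
  have hφ : ContinuousOn (fun l => saddleFun f g ρ (w l) l) (Set.Icc 0 L) := by
    have hl : LipschitzOnWith K.toNNReal (fun l => saddleFun f g ρ (w l) l) (Set.Icc 0 L) := by
      apply LipschitzOnWith.of_le_add_mul
      intro a ha b hb
      rw [Real.coe_toNNReal _ hK0, Real.dist_eq]
      exact (hw a _ (hwY b)).trans (hlip _ (hwY b) a ha b hb)
    exact hl.continuousOn
  obtain ⟨p, hp, hpmax⟩ := isCompact_Icc.exists_isMaxOn (Set.nonempty_Icc.2 hL) hφ
  refine ⟨(w p, p), hwY p, hp, ?_⟩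
  suffices h : ∀ lam ∈ Set.Icc 0 L, saddleFun f g ρ (w p) lam ≤ saddleFun f g ρ (w p) p from
    fun y hy lam hlam => (h lam hlam).trans (hw p y hy)
  intro lam hlam
  set t : ℕ → ℝ := fun n => 1 / ((n : ℝ) + 1) with ht
  have ht0 : ∀ n, 0 < t n := fun n => by positivity
  have ht1 : ∀ n, t n ≤ 1 := fun n => by
    rw [ht]; simp only; rw [div_le_one (by positivity)]; linarith [n.cast_nonneg (α := ℝ)]
  have htlim : Tendsto t atTop (𝓝 0) := tendsto_one_div_add_atTop_nhds_zero_nat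
  set l : ℕ → ℝ := fun n => (1 - t n) * p + t n * lam with hl
  have hlmem : ∀ n, l n ∈ Set.Icc 0 L := fun n =>
    (convex_Icc 0 L) hp hlam (by linarith [ht1 n]) (ht0 n).le (by ring)
  have hle : ∀ n, saddleFun f g ρ (w (l n)) lam ≤ saddleFun f g ρ (w p) p := by
    intro n
    have h1 : saddleFun f g ρ (w (l n)) (l n) ≤ saddleFun f g ρ (w p) p := hpmax (hlmem n)
    have h2 := hw p _ (hwY (l n))
    have h3 : (1 - t n) * saddleFun f g ρ (w (l n)) p + t n * saddleFun f g ρ (w (l n)) lam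
        ≤ saddleFun f g ρ (w (l n)) (l n) := by
      have h4 : 0 ≤ ρ * (t n * (1 - t n) * (lam - p) ^ 2) := by
        have := ht1 n; have := ht0 n
        have h5 : 0 ≤ 1 - t n := by linarith
        positivity
      simp only [saddleFun, hl, Real.norm_eq_abs, sq_abs]
      nlinarith
    refine le_of_mul_le_mul_left ?_ (ht0 n)
    nlinarith [mul_le_mul_of_nonneg_left h2 (by linarith [ht1 n] : 0 ≤ 1 - t n)]
  have hconv : Tendsto (fun n => w (l n)) atTop (𝓝 (w p)) := by
    -- Growth around `w p` bounds `ρ` times the left side by the suboptimality of `w (l n)` at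
    -- multiplier `p`. Passing from `p` to `l n` and back costs `K |l n - p|` each way.
    have h1 : ∀ n, ‖w (l n) - w p‖ ^ 2 ≤ 2 * K * |lam - p| / ρ * t n := by
      intro n
      have h2 := saddleFun_quadratic_growth hf hg hp.1 (hwY p) (hw p) (hwY (l n))
      have h3 := hlip _ (hwY (l n)) p hp _ (hlmem n)
      have h4 := hw (l n) _ (hwY p)
      have h5 := hlip _ (hwY p) _ (hlmem n) p hp
      have h6 : |l n - p| = t n * |lam - p| := by
        rw [show l n - p = t n * (lam - p) by simp only [hl]; ring, abs_mul, abs_of_pos (ht0 n)]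
      rw [abs_sub_comm, h6] at h3
      rw [h6] at h5
      rw [div_mul_eq_mul_div, le_div_iff₀ hρ]
      nlinarith
    have h7 : Tendsto (fun n => ‖w (l n) - w p‖ ^ 2) atTop (𝓝 0) :=
      squeeze_zero (fun n => by positivity) h1 (by simpa using htlim.const_mul _)
    have h8 := h7.sqrt
    simp only [Real.sqrt_sq (norm_nonneg _), Real.sqrt_zero] at h8
    exact tendsto_iff_norm_sub_tendsto_zero.2 h8
  have hconv' : Tendsto (fun n => w (l n)) atTop (𝓝[Y] (w p)) :=
    tendsto_nhdsWithin_iff.2 ⟨hconv, Eventually.of_forall fun n => hwY _⟩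
  exact le_of_tendsto ((hFy lam (w p) (hwY p)).tendsto.comp hconv') (Eventually.of_forall hle)

/-- **Minimax theorem** for regularized Lagrangians. -/
theorem exists_isSaddle {Y : Set V} (hY : IsCompact Y) (hne : Y.Nonempty) {L : ℝ}
    (hL : 0 ≤ L) {f g : V → ℝ} (hf : ConvexOn ℝ Y f) (hg : ConvexOn ℝ Y g)
    (hfc : ContinuousOn f Y) (hgc : ContinuousOn g Y) {ρ : ℝ} (hρ : 0 ≤ ρ) :
    ∃ p, IsSaddle Y (Set.Icc 0 L) (saddleFun f g ρ) p := by
  -- The case `ρ = 0` is reached by positive weights: a cluster point of their saddle points is a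
  -- saddle point for the limiting weight.
  set r : ℕ → ℝ := fun n => ρ + 1 / ((n : ℝ) + 1) with hr
  have hr0 : ∀ n, 0 < r n := fun n => by positivity
  have hrlim : Tendsto r atTop (𝓝 ρ) := by
    simpa only [add_zero] using tendsto_one_div_add_atTop_nhds_zero_nat.const_add (M := ℝ) ρ
  choose p hp using fun n => exists_isSaddle_of_pos hY hne hL hf hg hfc hgc (hr0 n)
  obtain ⟨q, hq, φ, hφ, hlim⟩ := (hY.prod (isCompact_Icc (a := 0) (b := L))).tendsto_subseq
    (x := p) fun n => ⟨(hp n).1, (hp n).2.1⟩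
  refine ⟨q, hq.1, hq.2, fun y hy lam hlam => ?_⟩
  have hc := continuousOn_saddleFun hfc hgc
  have hlim1 := (continuous_fst.tendsto q).comp hlim
  have hlim2 := (continuous_snd.tendsto q).comp hlim
  have hrφ := hrlim.comp hφ.tendsto_atTop
  have h1 : Tendsto (fun n => saddleFun f g (r (φ n)) (p (φ n)).1 lam) atTop
      (𝓝 (saddleFun f g ρ q.1 lam)) := by
    have := (hc (q.1, ρ, lam) ⟨hq.1, trivial⟩).tendsto.comp
      (tendsto_nhdsWithin_iff.2 ⟨hlim1.prodMk_nhds (hrφ.prodMk_nhds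
        (tendsto_const_nhds (x := lam))), Eventually.of_forall fun n => ⟨(hp _).1, trivial⟩⟩)
    exact this
  have h2 : Tendsto (fun n => saddleFun f g (r (φ n)) y (p (φ n)).2) atTop
      (𝓝 (saddleFun f g ρ y q.2)) := by
    have := (hc (y, ρ, q.2) ⟨hy, trivial⟩).tendsto.comp
      (tendsto_nhdsWithin_iff.2 ⟨(tendsto_const_nhds (x := y)).prodMk_nhds (hrφ.prodMk_nhds
        hlim2), Eventually.of_forall fun n => ⟨hy, trivial⟩⟩)
    exact this
  exact le_of_tendsto_of_tendsto' h1 h2 fun n => (hp _).2.2 y hy lam hlam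

/-- This is what allows the experts, defined by separate minimax problems, to be treated through
saddle inequalities alone. -/
theorem isMinimaxPair_saddleFun_iff {Y : Set V} (hY : IsCompact Y) (hne : Y.Nonempty) {L : ℝ}
    (hL : 0 ≤ L) {f g : V → ℝ} (hf : ConvexOn ℝ Y f) (hg : ConvexOn ℝ Y g)
    (hfc : ContinuousOn f Y) (hgc : ContinuousOn g Y) {ρ : ℝ} (hρ : 0 ≤ ρ) {p : V × ℝ} :
    IsMinimaxPair Y (Set.Icc 0 L) (saddleFun f g ρ) p
      ↔ IsSaddle Y (Set.Icc 0 L) (saddleFun f g ρ) p := by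
  obtain ⟨q, hq⟩ := exists_isSaddle hY hne hL hf hg hfc hgc hρ
  exact ⟨fun h => h.isSaddle hq (fun y _ => bddAbove_range_saddleFun y)
      fun l _ => bddBelow_range_saddleFun hY hfc hgc l,
    fun h => h.isMinimaxPair (fun y _ => bddAbove_range_saddleFun y)
      fun l _ => bddBelow_range_saddleFun hY hfc hgc l⟩

/-- **Strong duality**: if the dual problem has a maximizer in `[0, L)`, then the primal problem
has a solution whose value is the saddle value of the Lagrangian on `Y × [0, L]`. -/
theorem exists_solution_of_dual_optimal {Y : Set V} (hY : IsCompact Y) (hne : Y.Nonempty) {L : ℝ}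
    {f g : V → ℝ} (hf : ConvexOn ℝ Y f) (hg : ConvexOn ℝ Y g)
    (hfc : ContinuousOn f Y) (hgc : ContinuousOn g Y) {l : ℝ} (hl0 : 0 ≤ l) (hlL : l < L)
    (hl : IsMaxOn (fun l : ℝ => ⨅ y : Y, (f y + l * g y)) (Set.Ici 0) l) :
    ∃ y ∈ Y, g y ≤ 0 ∧ (∀ z ∈ Y, g z ≤ 0 → f y ≤ f z) ∧
      ∀ p, IsSaddle Y (Set.Icc 0 L) (saddleFun f g 0) p → f y = saddleFun f g 0 p.1 p.2 := by
  have hS : ∀ y l, saddleFun f g 0 y l = f y + l * g y := fun y l => by simp [saddleFun]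
  have hL : 0 ≤ L := hl0.trans hlL.le
  obtain ⟨q, hq⟩ := exists_isSaddle hY hne hL hf hg hfc hgc le_rfl
  have hbb : ∀ l : ℝ, BddBelow (Set.range fun y : Y => f y + l * g y) := fun l => by
    simpa only [hS] using bddBelow_range_saddleFun hY hfc hgc (ρ := 0) l
  have : Nonempty Y := hne.to_subtype
  -- The multiplier of a saddle point can be exchanged for the given dual optimum, whose dual value
  -- is at least as large.
  have hs : IsSaddle Y (Set.Icc 0 L) (saddleFun f g 0) (q.1, l) := by
    refine ⟨hq.1, ⟨hl0, hlL.le⟩, fun y hy lam hlam => ?_⟩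
    refine (hq.le_left hlam).trans ?_
    have h1 : q.1 ∈ Y := hq.1
    have h2 : (⨅ y : Y, (f y + q.2 * g y)) ≤ ⨅ y : Y, (f y + l * g y) := hl hq.2.1.1
    rw [hS, hS]
    refine le_trans ?_ (h2.trans (ciInf_le (hbb l) ⟨y, hy⟩))
    refine le_ciInf fun z => ?_
    have := hq.le_right z.2
    rwa [hS, hS] at this
  -- Testing the multiplier `L`, strictly above `l`, forces feasibility `g q.1 ≤ 0`. Testing `0`
  -- then gives complementary slackness `l * g q.1 = 0`.
  have h1 := hs.le_left (lam := L) ⟨hL, le_rfl⟩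
  have h2 := hs.le_left (lam := 0) ⟨le_rfl, hL⟩
  simp only [hS] at h1 h2
  have hg0 : g q.1 ≤ 0 := by
    by_contra! hc
    nlinarith
  have hcs : l * g q.1 = 0 := le_antisymm (mul_nonpos_of_nonneg_of_nonpos hl0 hg0) (by linarith)
  refine ⟨q.1, hq.1, hg0, fun z hz hgz => ?_, fun p hp => ?_⟩
  · have h3 := hs.le_right hz
    simp only [hS] at h3
    have := mul_nonpos_of_nonneg_of_nonpos hl0 hgz
    linarith
  · have h3 := hs.abs_value_sub_le hp (ε := 0) (by simp)
    have h4 := abs_nonpos_iff.1 h3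
    simp only [hS] at h4 ⊢
    linarith

end Minimax

/-! ### Birkhoff's ergodic theorem for bounded functions. -/

section Ergodic

variable {α : Type*}

/-- The running maximum of the Birkhoff sums of `g` of orders `0, …, n`. -/
def maxBirkhoffSum (T : α → α) (g : α → ℝ) : ℕ → α → ℝ
  | 0, _ => 0
  | n + 1, x => max 0 (g x + maxBirkhoffSum T g n (T x))

theorem maxBirkhoffSum_nonneg (T : α → α) (g : α → ℝ) (n : ℕ) (x : α) :
    0 ≤ maxBirkhoffSum T g n x := by
  cases n with
  | zero => exact le_rfl
  | succ n => exact le_max_left _ _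

theorem maxBirkhoffSum_le_succ (T : α → α) (g : α → ℝ) (n : ℕ) (x : α) :
    maxBirkhoffSum T g n x ≤ maxBirkhoffSum T g (n + 1) x := by
  induction n generalizing x with
  | zero => exact maxBirkhoffSum_nonneg T g 1 x
  | succ n ih =>
    rw [maxBirkhoffSum, maxBirkhoffSum]
    exact max_le_max le_rfl (by linarith [ih (T x)])

theorem birkhoffSum_le_maxBirkhoffSum (T : α → α) (g : α → ℝ) (n : ℕ) (x : α) :
    birkhoffSum T g n x ≤ maxBirkhoffSum T g n x := by
  induction n generalizing x with
  | zero => simp [maxBirkhoffSum]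
  | succ n ih =>
    rw [birkhoffSum_succ', maxBirkhoffSum]
    exact le_max_of_le_right (by linarith [ih (T x)])

theorem maxBirkhoffSum_le (T : α → α) {g : α → ℝ} {C : ℝ} (hC : ∀ x, |g x| ≤ C) (n : ℕ) (x : α) :
    maxBirkhoffSum T g n x ≤ n * C := by
  have hC0 : 0 ≤ C := (abs_nonneg _).trans (hC x)
  induction n generalizing x with
  | zero => simp [maxBirkhoffSum]
  | succ n ih =>
    rw [maxBirkhoffSum]
    refine max_le (by positivity) ?_
    have := (abs_le.1 (hC x)).2
    push_cast
    linarith [ih (T x)]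

variable [MeasurableSpace α]

theorem measurable_maxBirkhoffSum {T : α → α} (hT : Measurable T) {g : α → ℝ} (hg : Measurable g)
    (n : ℕ) : Measurable (maxBirkhoffSum T g n) := by
  induction n with
  | zero => exact measurable_const
  | succ n ih => exact measurable_const.max (hg.add (ih.comp hT))

/-- The set where the running maxima `M n` are unbounded is invariant, hence null or of full
measure. In the second case `M (n+1) - M n ∘ T = max g (-M n ∘ T)` tends to `g` almost everywhere
and stays within the bound `C`. Its integral equals that of `M (n+1) - M n ≥ 0`, so `∫ g ≥ 0`, a
contradiction. -/
theorem ae_bddAbove_maxBirkhoffSum {μ : Measure α} [IsProbabilityMeasure μ] {T : α → α}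
    (hT : Ergodic T μ) {g : α → ℝ} (hg : Measurable g) {C : ℝ} (hC : ∀ x, |g x| ≤ C)
    (hneg : ∫ x, g x ∂μ < 0) :
    ∀ᵐ x ∂μ, BddAbove (Set.range fun n => maxBirkhoffSum T g n x) := by
  set M := maxBirkhoffSum T g with hM
  have hMm := fun n => measurable_maxBirkhoffSum hT.measurable hg n
  have hmono : ∀ x, Monotone fun n => M n x := fun x =>
    monotone_nat_of_le_succ fun n => maxBirkhoffSum_le_succ T g n x
  set A : Set α := {x | ¬ BddAbove (Set.range fun n => M n x)} with hA
  have hAeq : A = ⋂ k : ℕ, ⋃ n : ℕ, {x | (k : ℝ) < M n x} := by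
    ext x
    simp only [hA, Set.mem_ofPred_eq, Set.mem_iInter, Set.mem_iUnion, not_bddAbove_iff,
      Set.exists_range_iff]
    refine ⟨fun h k => h k, fun h r => ?_⟩
    obtain ⟨k, hk⟩ := exists_nat_gt r
    obtain ⟨n, hn⟩ := h k
    exact ⟨n, hk.trans hn⟩
  have hAm : MeasurableSet A := by
    rw [hAeq]
    exact MeasurableSet.iInter fun k => MeasurableSet.iUnion fun n =>
      measurableSet_lt measurable_const (hMm n)
  have hinv : T ⁻¹' A = A := by
    ext x
    simp only [hA, Set.mem_preimage, Set.mem_ofPred_eq, not_iff_not]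
    constructor
    · rintro ⟨B, hB⟩
      refine ⟨max 0 (g x + B), ?_⟩
      rintro _ ⟨n, rfl⟩
      have h1 : M n (T x) ≤ B := hB ⟨n, rfl⟩
      refine (hmono x n.le_succ).trans ?_
      exact max_le_max le_rfl (by linarith)
    · rintro ⟨B, hB⟩
      refine ⟨B - g x, ?_⟩
      rintro _ ⟨n, rfl⟩
      have h1 : M (n + 1) x ≤ B := hB ⟨n + 1, rfl⟩
      have h2 : g x + M n (T x) ≤ M (n + 1) x := le_max_right _ _
      linarith
  rcases hT.toPreErgodic.ae_empty_or_univ hAm hinv with h | h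
  · have := (ae_eq_empty.1 h)
    filter_upwards [measure_eq_zero_iff_ae_notMem.1 this] with x hx
    exact not_not.1 hx
  · exfalso
    have hAae : ∀ᵐ x ∂μ, x ∈ A := by
      have := eventuallyEq_univ.1 h
      exact this
    have hC0 : 0 ≤ C := by
      obtain ⟨x, -⟩ := hAae.exists
      exact (abs_nonneg _).trans (hC x)
    have hMint : ∀ n, Integrable (M n) μ := fun n =>
      Integrable.of_bound (hMm n).aestronglyMeasurable (n * C) (Eventually.of_forall fun x => by
        rw [Real.norm_eq_abs, abs_of_nonneg (maxBirkhoffSum_nonneg T g n x)]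
        exact maxBirkhoffSum_le T hC n x)
    have hMTint : ∀ n, Integrable (fun x => M n (T x)) μ := fun n =>
      (hT.toMeasurePreserving.integrable_comp (hMint n).aestronglyMeasurable).2 (hMint n)
    have hnn : ∀ n, 0 ≤ ∫ x, max (g x) (-M n (T x)) ∂μ := by
      intro n
      have h1 : ∀ x, max (g x) (-M n (T x)) = M (n + 1) x - M n (T x) := by
        intro x
        rw [hM, maxBirkhoffSum, ← max_sub_sub_right, max_comm, zero_sub, add_sub_cancel_right]
      have h2 : ∫ x, M n (T x) ∂μ = ∫ x, M n x ∂μ := by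
        have := integral_map (μ := μ) hT.measurable.aemeasurable (f := M n)
          (hMm n).aestronglyMeasurable
        rw [← this, hT.map_eq]
      simp only [h1]
      rw [integral_sub (hMint _) (hMTint _), h2, sub_nonneg]
      exact integral_mono (hMint _) (hMint _) fun x => hmono x n.le_succ
    have hlim : Tendsto (fun n => ∫ x, max (g x) (-M n (T x)) ∂μ) atTop (𝓝 (∫ x, g x ∂μ)) := by
      refine tendsto_integral_of_dominated_convergence (fun _ => C) (fun n => ?_)
        (integrable_const C) (fun n => Eventually.of_forall fun x => ?_) ?_
      · exact (hg.max ((hMm n).comp hT.measurable).neg).aestronglyMeasurable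
      · have h1 := abs_le.1 (hC x)
        have h2 := maxBirkhoffSum_nonneg T g n (T x)
        rw [Real.norm_eq_abs, abs_le]
        exact ⟨h1.1.trans (le_max_left _ _), max_le h1.2 (by linarith)⟩
      · filter_upwards [hAae] with x hx
        have hx' : ¬ BddAbove (Set.range fun n => M n (T x)) := by
          have : x ∈ T ⁻¹' A := by rwa [hinv]
          exact this
        rw [not_bddAbove_iff] at hx'
        obtain ⟨_, ⟨n, rfl⟩, hn⟩ := hx' (-g x)
        refine tendsto_const_nhds.congr' ?_
        filter_upwards [eventually_ge_atTop n] with k hk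
        have := hmono (T x) hk
        simp only at this hn
        rw [max_eq_left]; linarith
    exact absurd (ge_of_tendsto' hlim hnn) (not_le.2 hneg)

/-- The function `f - (∫ f + ε)` has negative mean, so its Birkhoff sums are bounded above by some
`B`. The second `ε` absorbs `B / n`. -/
theorem ae_eventually_birkhoffAverage_le {μ : Measure α} [IsProbabilityMeasure μ] {T : α → α}
    (hT : Ergodic T μ) {f : α → ℝ} (hf : Measurable f) {C : ℝ} (hC : ∀ x, |f x| ≤ C)
    {ε : ℝ} (hε : 0 < ε) :
    ∀ᵐ x ∂μ, ∀ᶠ n : ℕ in atTop, (1 / (n : ℝ)) * birkhoffSum T f n x ≤ ∫ x, f x ∂μ + 2 * ε := by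
  set I := ∫ x, f x ∂μ with hI
  have hfint : Integrable f μ := Integrable.of_bound hf.aestronglyMeasurable C
    (Eventually.of_forall hC)
  have key := ae_bddAbove_maxBirkhoffSum hT (g := fun x => f x - (I + ε))
    (hf.sub measurable_const) (C := C + |I + ε|)
    (fun x => (abs_sub _ _).trans (by linarith [hC x])) (by
      rw [integral_sub hfint (integrable_const _)]
      simp [← hI, hε])
  filter_upwards [key] with x ⟨B, hB⟩
  have hsum : ∀ n : ℕ, birkhoffSum T f n x ≤ n * (I + ε) + B := by
    intro n
    have h1 := birkhoffSum_le_maxBirkhoffSum T (fun x => f x - (I + ε)) n x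
    have h2 : maxBirkhoffSum T (fun x => f x - (I + ε)) n x ≤ B := hB ⟨n, rfl⟩
    have h3 : birkhoffSum T (fun x => f x - (I + ε)) n x = birkhoffSum T f n x - n * (I + ε) := by
      simp [birkhoffSum, Finset.sum_sub_distrib, mul_add]
    linarith
  obtain ⟨N, hN⟩ := exists_nat_gt (B / ε)
  filter_upwards [eventually_ge_atTop (max N 1)] with n hn
  have hn1 : (0 : ℝ) < n := by
    have : 1 ≤ n := le_of_max_le_right hn
    exact_mod_cast this
  have hnN : (N : ℝ) ≤ n := by exact_mod_cast le_of_max_le_left hn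
  rw [div_lt_iff₀ hε] at hN
  rw [one_div, inv_mul_le_iff₀ hn1]
  nlinarith [hsum n]

/-- **Birkhoff's pointwise ergodic theorem** for bounded functions. -/
theorem ae_tendsto_birkhoffSum_div {μ : Measure α} [IsProbabilityMeasure μ] {T : α → α}
    (hT : Ergodic T μ) {f : α → ℝ} (hf : Measurable f) {C : ℝ} (hC : ∀ x, |f x| ≤ C) :
    ∀ᵐ x ∂μ, Tendsto (fun n : ℕ => (1 / (n : ℝ)) * birkhoffSum T f n x) atTop
      (𝓝 (∫ x, f x ∂μ)) := by
  have h1 : ∀ k : ℕ, ∀ᵐ x ∂μ, ∀ᶠ n : ℕ in atTop,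
      (1 / (n : ℝ)) * birkhoffSum T f n x ≤ ∫ x, f x ∂μ + 2 * (1 / ((k : ℝ) + 1)) := fun k =>
    ae_eventually_birkhoffAverage_le hT hf hC (by positivity)
  have h2 : ∀ k : ℕ, ∀ᵐ x ∂μ, ∀ᶠ n : ℕ in atTop,
      (1 / (n : ℝ)) * birkhoffSum T (fun x => - f x) n x
        ≤ ∫ x, - f x ∂μ + 2 * (1 / ((k : ℝ) + 1)) := fun k =>
    ae_eventually_birkhoffAverage_le hT hf.neg (C := C) (by simpa using hC) (by positivity)
  filter_upwards [ae_all_iff.2 h1, ae_all_iff.2 h2] with x hx1 hx2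
  rw [Metric.tendsto_nhds]
  intro ε hε
  obtain ⟨k, hk⟩ := exists_nat_one_div_lt (by positivity : (0 : ℝ) < ε / 2)
  filter_upwards [hx1 k, hx2 k] with n hn1 hn2
  have h3 : birkhoffSum T (fun x => - f x) n x = - birkhoffSum T f n x := by
    simp [birkhoffSum, Finset.sum_neg_distrib]
  rw [h3, integral_neg, mul_neg] at hn2
  rw [Real.dist_eq, abs_lt]
  constructor <;> linarith

end Ergodic

/-! ### Uniform convergence of Lagrangians. -/

section Convergence

/-- A family of functions that is uniformly equicontinuous on `Y`. -/
def UnifEquicontOn {ι V : Type*} [PseudoMetricSpace V] (Y : Set V) (F : ι → V → ℝ) : Prop :=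
  ∀ ε > 0, ∃ δ > 0, ∀ y ∈ Y, ∀ z ∈ Y, dist y z < δ → ∀ i, |F i y - F i z| ≤ ε

/-- Almost sure limits are available simultaneously only for countably many decisions.
Equicontinuity and a finite cover of the compact set spread them to all of `Y`, uniformly. -/
theorem tendstoUniformlyOn_of_dense {ι V : Type*} [PseudoMetricSpace V] {Y D : Set V}
    (hY : IsCompact Y) (hDY : D ⊆ Y) (hD : Y ⊆ closure D) {F : ι → V → ℝ} {G : V → ℝ}
    (hF : UnifEquicontOn Y F) (hG : UnifEquicontOn Y fun _ : Unit => G) {l : Filter ι}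
    (h : ∀ y ∈ D, Tendsto (fun i => F i y) l (𝓝 (G y))) : TendstoUniformlyOn F G l Y := by
  rw [Metric.tendstoUniformlyOn_iff]
  intro ε hε
  obtain ⟨δ, hδ, hFδ⟩ := hF (ε / 4) (by positivity)
  obtain ⟨η, hη, hGη⟩ := hG (ε / 4) (by positivity)
  have hcover : Y ⊆ ⋃ y ∈ D, Metric.ball y (min δ η) := by
    intro y hy
    obtain ⟨z, hz, hyz⟩ := Metric.mem_closure_iff.1 (hD hy) _ (lt_min hδ hη)
    exact Set.mem_biUnion hz hyz
  obtain ⟨t, htD, htf, htc⟩ := hY.elim_finite_subcover_image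
    (fun y _ => Metric.isOpen_ball) hcover
  have hev : ∀ᶠ i in l, ∀ y ∈ t, |F i y - G y| < ε / 4 := by
    rw [eventually_all_finite htf]
    intro y hy
    have := Metric.tendsto_nhds.1 (h y (htD hy)) (ε / 4) (by positivity)
    simpa [Real.dist_eq] using this
  filter_upwards [hev] with i hi y hy
  obtain ⟨z, hz, hyz⟩ := Set.mem_iUnion₂.1 (htc hy)
  rw [Metric.mem_ball] at hyz
  have h1 := abs_le.1 (hFδ y hy z (hDY (htD hz)) (hyz.trans_le (min_le_left _ _)) i)
  have h2 := abs_le.1 (hGη y hy z (hDY (htD hz)) (hyz.trans_le (min_le_right _ _)) ())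
  have h3 := abs_lt.1 (hi z hz)
  rw [Real.dist_eq, abs_lt]
  constructor <;> linarith

variable {V : Type*} [NormedAddCommGroup V] {ι : Type*} {l : Filter ι}

theorem eventually_abs_saddleFun_sub_le {Y : Set V} (hY : IsCompact Y) {L : ℝ}
    {F G : ι → V → ℝ} {r : ι → ℝ} {f g : V → ℝ} {ρ : ℝ}
    (hF : TendstoUniformlyOn F f l Y) (hG : TendstoUniformlyOn G g l Y)
    (hr : Tendsto r l (𝓝 ρ)) {ε : ℝ} (hε : 0 < ε) :
    ∀ᶠ i in l, ∀ y ∈ Y, ∀ lam ∈ Set.Icc 0 L,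
      |saddleFun f g ρ y lam - saddleFun (F i) (G i) (r i) y lam| ≤ ε := by
  obtain ⟨K, hK0, hK⟩ := hY.isBounded.exists_pos_norm_le
  -- Each of the three terms receives `ε / 4`. The denominators dominate the multiplier and the
  -- penalty `‖y‖ ^ 2 - ‖lam‖ ^ 2`, with a `1` added to stay positive.
  have h1 := Metric.tendstoUniformlyOn_iff.1 hF (ε / 4) (by positivity)
  have h2 := Metric.tendstoUniformlyOn_iff.1 hG (ε / (4 * (1 + |L|))) (by positivity)
  have h3 := Metric.tendsto_nhds.1 hr (ε / (4 * (1 + K ^ 2 + |L| ^ 2))) (by positivity)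
  filter_upwards [h1, h2, h3] with i h1 h2 h3 y hy lam hlam
  have e1 := (h1 y hy).le
  have e2 := (h2 y hy).le
  have e3 := h3.le
  have hl : |lam| ≤ |L| := by
    rw [abs_of_nonneg hlam.1]; exact hlam.2.trans (le_abs_self L)
  have hy2 : ‖y‖ ^ 2 ≤ K ^ 2 := pow_le_pow_left₀ (norm_nonneg _) (hK y hy) 2
  have hl2 : ‖lam‖ ^ 2 ≤ |L| ^ 2 := pow_le_pow_left₀ (norm_nonneg _) hl 2
  rw [Real.dist_eq] at e1 e2 e3
  have b1 : |lam * (g y - G i y)| ≤ ε / 4 := by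
    rw [abs_mul]
    calc |lam| * |g y - G i y| ≤ (1 + |L|) * (ε / (4 * (1 + |L|))) := by
          apply mul_le_mul (by linarith) e2 (abs_nonneg _) (by positivity)
      _ = ε / 4 := by field_simp
  have b2 : |(‖y‖ ^ 2 - ‖lam‖ ^ 2) * (r i - ρ)| ≤ ε / 4 := by
    rw [abs_mul]
    calc _ ≤ (1 + K ^ 2 + |L| ^ 2) * (ε / (4 * (1 + K ^ 2 + |L| ^ 2))) := by
          apply mul_le_mul _ e3 (abs_nonneg _) (by positivity)
          rw [abs_le]
          constructor <;> nlinarith [sq_nonneg ‖y‖, sq_nonneg ‖lam‖]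
      _ = ε / 4 := by field_simp
  have e1' := abs_le.1 e1
  have b1' := abs_le.1 b1
  have b2' := abs_le.1 b2
  simp only [saddleFun]
  rw [abs_le]
  constructor <;> linarith

end Convergence

/-! ### Convergence of saddle points and of saddle values. -/

section SaddleConvergence

variable {V : Type*} [NormedAddCommGroup V] [InnerProductSpace ℝ V] {ι : Type*} {l : Filter ι}

/-- Saddle points of Lagrangians that converge uniformly to a regularized one converge. -/
theorem tendsto_saddle {Y : Set V} (hY : IsCompact Y) {L : ℝ}
    {F G : ι → V → ℝ} {r : ι → ℝ} {f g : V → ℝ} {ρ : ℝ}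
    (hF : TendstoUniformlyOn F f l Y) (hG : TendstoUniformlyOn G g l Y)
    (hr : Tendsto r l (𝓝 ρ)) (hρ : 0 < ρ) (hf : ConvexOn ℝ Y f) (hg : ConvexOn ℝ Y g)
    {p : ι → V × ℝ} {q : V × ℝ}
    (hp : ∀ᶠ i in l, IsSaddle Y (Set.Icc 0 L) (saddleFun (F i) (G i) (r i)) (p i))
    (hq : IsSaddle Y (Set.Icc 0 L) (saddleFun f g ρ) q) : Tendsto p l (𝓝 q) := by
  rw [Metric.tendsto_nhds]
  intro ε hε
  -- A perturbation of size `ρ ε² / 4` yields squared distance at most `ε² / 2`.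
  filter_upwards [hp, eventually_abs_saddleFun_sub_le (L := L) hY hF hG hr
    (by positivity : 0 < ρ * ε ^ 2 / 4)] with i hi hd
  have h1 := hq.dist_sq_le hf hg hi hd
  have h2 : ‖(p i).1 - q.1‖ ^ 2 + ((p i).2 - q.2) ^ 2 < ε ^ 2 := by
    have : ρ * (‖(p i).1 - q.1‖ ^ 2 + ((p i).2 - q.2) ^ 2) < ρ * ε ^ 2 := by
      have : 0 < ρ * ε ^ 2 := by positivity
      linarith
    exact lt_of_mul_lt_mul_left this hρ.le
  rw [Prod.dist_eq, max_lt_iff, dist_eq_norm, Real.dist_eq]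
  constructor
  · exact lt_of_pow_lt_pow_left₀ 2 hε.le (by nlinarith [sq_nonneg ((p i).2 - q.2)])
  · exact abs_lt_of_sq_lt_sq (by nlinarith [sq_nonneg ‖(p i).1 - q.1‖]) hε.le

/-- The unregularized values at saddle points converge. -/
theorem tendsto_saddle_value {Y : Set V} (hY : IsCompact Y) {L : ℝ}
    {F G : ι → V → ℝ} {r : ι → ℝ} {f g : V → ℝ} {ρ : ℝ}
    (hF : TendstoUniformlyOn F f l Y) (hG : TendstoUniformlyOn G g l Y)
    (hr : Tendsto r l (𝓝 ρ)) (hρ : 0 ≤ ρ) (hf : ConvexOn ℝ Y f) (hg : ConvexOn ℝ Y g)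
    {p : ι → V × ℝ} {q : V × ℝ}
    (hp : ∀ᶠ i in l, IsSaddle Y (Set.Icc 0 L) (saddleFun (F i) (G i) (r i)) (p i))
    (hq : IsSaddle Y (Set.Icc 0 L) (saddleFun f g ρ) q) :
    Tendsto (fun i => saddleFun (F i) (G i) 0 (p i).1 (p i).2) l
      (𝓝 (saddleFun f g 0 q.1 q.2)) := by
  have h1 : Tendsto (fun i => saddleFun (F i) (G i) (r i) (p i).1 (p i).2) l
      (𝓝 (saddleFun f g ρ q.1 q.2)) := by
    rw [Metric.tendsto_nhds]
    intro ε hε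
    filter_upwards [hp, eventually_abs_saddleFun_sub_le (L := L) hY hF hG hr
      (by positivity : 0 < ε / 2)] with i hi hd
    have := hq.abs_value_sub_le hi hd
    rw [dist_comm, Real.dist_eq]
    linarith
  have h2 : Tendsto (fun i => (‖(p i).1‖ ^ 2 - ‖(p i).2‖ ^ 2) * r i) l
      (𝓝 ((‖q.1‖ ^ 2 - ‖q.2‖ ^ 2) * ρ)) := by
    -- For `ρ = 0` the saddle points need not converge, but they stay bounded and the penalty
    -- vanishes with its weight. For `ρ > 0` they do converge.
    rcases hρ.eq_or_lt with h0 | hpos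
    · subst h0
      obtain ⟨K, hK0, hK⟩ := hY.isBounded.exists_pos_norm_le
      have hbd : ∀ᶠ i in l, |(‖(p i).1‖ ^ 2 - ‖(p i).2‖ ^ 2) * r i|
          ≤ (K ^ 2 + L ^ 2) * |r i| := by
        filter_upwards [hp] with i hi
        rw [abs_mul]
        refine mul_le_mul_of_nonneg_right ?_ (abs_nonneg _)
        have a1 := pow_le_pow_left₀ (norm_nonneg _) (hK _ hi.1) 2
        have a2 : ‖(p i).2‖ ^ 2 ≤ L ^ 2 := by
          rw [Real.norm_eq_abs, sq_abs]
          exact pow_le_pow_left₀ hi.2.1.1 hi.2.1.2 2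
        rw [abs_le]
        constructor <;> nlinarith [sq_nonneg ‖(p i).1‖, sq_nonneg ‖(p i).2‖]
      rw [mul_zero]
      refine squeeze_zero_norm' hbd ?_
      simpa using hr.abs.const_mul (K ^ 2 + L ^ 2)
    · have hlim := tendsto_saddle hY hF hG hr hpos hf hg hp hq
      have h1 := ((continuous_fst.tendsto q).comp hlim).norm.pow 2
      have h2 := ((continuous_snd.tendsto q).comp hlim).norm.pow 2
      exact (h1.sub h2).mul hr
  have h3 := h1.sub h2
  simpa [saddleFun] using h3

end SaddleConvergence

/-! ### Convex integrands and their conditional expectations. -/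

section Integrand

/-- An integrand `u(y, x)` that is bounded, measurable in `x`, convex in `y ∈ Y`, and continuous
in `y` uniformly in `x`. -/
structure IsIntegrand {V E : Type*} [NormedAddCommGroup V] [NormedSpace ℝ V] [MeasurableSpace E]
    (Y : Set V) (u : V → E → ℝ) : Prop where
  measurable : ∀ y ∈ Y, Measurable (u y)
  bounded : ∃ C, ∀ y ∈ Y, ∀ x, |u y x| ≤ C
  equicont : UnifEquicontOn Y fun x y => u y x
  convex : ∀ x, ConvexOn ℝ Y fun y => u y x

variable {V E : Type*} [NormedAddCommGroup V] [NormedSpace ℝ V] [MeasurableSpace E]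
  {Y : Set V} {u : V → E → ℝ}

theorem IsIntegrand.integrable (hu : IsIntegrand Y u) (P : Measure E) [IsFiniteMeasure P] {y : V}
    (hy : y ∈ Y) : Integrable (u y) P := by
  obtain ⟨C, hC⟩ := hu.bounded
  exact Integrable.of_bound (hu.measurable y hy).aestronglyMeasurable C
    (Eventually.of_forall (hC y hy))

theorem IsIntegrand.convexOn_integral (hY : Convex ℝ Y) (hu : IsIntegrand Y u) (P : Measure E)
    [IsFiniteMeasure P] : ConvexOn ℝ Y fun y => ∫ x, u y x ∂P := by
  refine ⟨hY, fun y hy z hz a b ha hb hab => ?_⟩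
  rw [smul_eq_mul, smul_eq_mul, ← integral_const_mul, ← integral_const_mul, ← integral_add
    ((hu.integrable P hy).const_mul a) ((hu.integrable P hz).const_mul b)]
  exact integral_mono (hu.integrable P (hY hy hz ha hb hab))
    (((hu.integrable P hy).const_mul a).add ((hu.integrable P hz).const_mul b))
    fun x => (hu.convex x).2 hy hz ha hb hab

theorem IsIntegrand.equicont_integral (hu : IsIntegrand Y u) {ι : Type*} (P : ι → Measure E)
    [∀ i, IsProbabilityMeasure (P i)] : UnifEquicontOn Y fun i y => ∫ x, u y x ∂(P i) := by
  intro ε hε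
  obtain ⟨δ, hδ, h⟩ := hu.equicont ε hε
  refine ⟨δ, hδ, fun y hy z hz hyz i => ?_⟩
  rw [← integral_sub (hu.integrable _ hy) (hu.integrable _ hz)]
  have := norm_integral_le_of_norm_le_const (μ := P i) (f := fun x => u y x - u z x) (C := ε)
    (Eventually.of_forall fun x => h y hy z hz hyz x)
  simpa using this

theorem UnifEquicontOn.continuousOn {ι V : Type*} [PseudoMetricSpace V] {Y : Set V}
    {F : ι → V → ℝ} (h : UnifEquicontOn Y F) (i : ι) : ContinuousOn (F i) Y := by
  rw [Metric.continuousOn_iff]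
  intro y hy ε hε
  obtain ⟨δ, hδ, h⟩ := h (ε / 2) (by positivity)
  refine ⟨δ, hδ, fun z hz hzy => ?_⟩
  rw [Real.dist_eq]
  linarith [h z hz y hy hzy i]

theorem IsIntegrand.continuousOn_integral (hu : IsIntegrand Y u) (P : Measure E)
    [IsProbabilityMeasure P] : ContinuousOn (fun y => ∫ x, u y x ∂P) Y :=
  (hu.equicont_integral fun _ : Unit => P).continuousOn ()

/-- **Lévy's upward theorem**, uniformly over an integrand. -/
theorem IsIntegrand.ae_tendstoUniformlyOn_condDistrib [StandardBorelSpace E] [Nonempty E]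
    {Ω : Type*} [mΩ : MeasurableSpace Ω] {μ : Measure Ω} [IsProbabilityMeasure μ]
    {β : ℕ → Type*} [mβ : ∀ n, MeasurableSpace (β n)] {β' : Type*} [mβ' : MeasurableSpace β']
    (hu : IsIntegrand Y u) (hY : IsCompact Y)
    {Z : ∀ n, Ω → β n} {Z' : Ω → β'} {W : Ω → E}
    (hZ : ∀ n, Measurable (Z n)) (hZ' : Measurable Z') (hW : Measurable W)
    (hmono : Monotone fun n => (mβ n).comap (Z n))
    (hsup : ⨆ n, (mβ n).comap (Z n) = mβ'.comap Z') :
    ∀ᵐ ω ∂μ, TendstoUniformlyOn (fun n y => ∫ x, u y x ∂(condDistrib W (Z n) μ (Z n ω)))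
      (fun y => ∫ x, u y x ∂(condDistrib W Z' μ (Z' ω))) atTop Y := by
  -- Martingale convergence is applied at countably many decisions, so that the exceptional sets
  -- have a null union.
  obtain ⟨D, hDY, hDc, hD⟩ := hY.isSeparable.exists_countable_dense_subset
  let ℱ : Filtration ℕ mΩ :=
    ⟨fun n => (mβ n).comap (Z n), hmono, fun n => (hZ n).comap_le⟩
  have key : ∀ᵐ ω ∂μ, ∀ y ∈ D, Tendsto
      (fun n => ∫ x, u y x ∂(condDistrib W (Z n) μ (Z n ω))) atTop
      (𝓝 (∫ x, u y x ∂(condDistrib W Z' μ (Z' ω)))) := by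
    rw [ae_ball_iff hDc]
    intro y hy
    obtain ⟨C, hC⟩ := hu.bounded
    have hm := hu.measurable y (hDY hy)
    have hint : Integrable (fun ω => u y (W ω)) μ :=
      Integrable.of_bound (hm.comp hW).aestronglyMeasurable C
        (Eventually.of_forall fun ω => hC y (hDY hy) _)
    have h1 := fun n => condExp_ae_eq_integral_condDistrib (hZ n) hW.aemeasurable
      hm.stronglyMeasurable hint
    have h2 := condExp_ae_eq_integral_condDistrib hZ' hW.aemeasurable
      hm.stronglyMeasurable hint
    have h3 := tendsto_ae_condExp (μ := μ) (ℱ := ℱ) fun ω => u y (W ω)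
    filter_upwards [ae_all_iff.2 h1, h2, h3] with ω h1 h2 h3
    have h4 : (⨆ n, ℱ n : MeasurableSpace Ω) = mβ'.comap Z' := hsup
    rw [h4, h2] at h3
    exact h3.congr fun n => h1 n
  filter_upwards [key] with ω hω
  exact tendstoUniformlyOn_of_dense hY hDY hD
    (hu.equicont_integral fun n => condDistrib W (Z n) μ (Z n ω))
    (hu.equicont_integral fun _ : Unit => condDistrib W Z' μ (Z' ω)) hω

theorem integral_condDistrib_eq [StandardBorelSpace E] [Nonempty E]
    {Ω : Type*} [MeasurableSpace Ω] {μ : Measure Ω} [IsProbabilityMeasure μ]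
    {β : Type*} [MeasurableSpace β] {Z : Ω → β} {W : Ω → E} (hZ : Measurable Z)
    (hW : Measurable W) {F : β × E → ℝ} (hF : Measurable F) {C : ℝ}
    (hC : ∀ ω, |F (Z ω, W ω)| ≤ C) :
    ∫ ω, F (Z ω, W ω) ∂μ = ∫ ω, ∫ x, F (Z ω, x) ∂(condDistrib W Z μ (Z ω)) ∂μ := by
  have hint : Integrable (fun ω => F (Z ω, W ω)) μ :=
    Integrable.of_bound (hF.comp (hZ.prodMk hW)).aestronglyMeasurable C (Eventually.of_forall hC)
  rw [← integral_congr_ae (condExp_prod_ae_eq_integral_condDistrib hZ hW.aemeasurable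
    hF.stronglyMeasurable hint), integral_condExp hZ.comap_le]

end Integrand

/-! ### Matching times read as contexts along a two-sided path. -/

section Paths

variable {E : Type*}

/-- The labels of `x (-1), …, x (-k)`. -/
def context (q : E → ℕ) (k : ℕ) (x : ℤ → E) : Fin k → ℕ := fun j => q (x (-((j : ℤ) + 1)))

/-- The path seen from time `n`. -/
def shiftPath (n : ℕ) (x : ℤ → E) : ℤ → E := fun i => x (i + n)

theorem context_shiftPath (q : E → ℕ) (k n : ℕ) (x : ℤ → E) (j : Fin k) :
    context q k (shiftPath (n + 1) x) j = q (x ((n : ℤ) - j)) := by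
  simp only [context, shiftPath]
  congr 2
  push_cast
  ring

/-- Entry `j` of the history is the observation at time `j + 1`, so `i` stands for time `i + 1` and
the round to predict is `n + 1`. This turns matching into a condition on shifted paths, to which
ergodic averages apply. -/
theorem mem_matchingTimes_iff (q : E → ℕ) (k : ℕ) {n : ℕ} (x : ℤ → E) (i : Fin n) :
    i ∈ matchingTimes q k (fun j : Fin n => x ((j : ℕ) + 1)) ↔
      k ≤ (i : ℕ) ∧ context q k (shiftPath (i + 1) x) = context q k (shiftPath (n + 1) x) := by
  simp only [matchingTimes, Finset.mem_filter, Finset.mem_univ, true_and]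
  refine and_congr_right fun hki => ⟨fun h => ?_, fun h a b hai hia hab => ?_⟩
  · funext j
    rw [context_shiftPath, context_shiftPath]
    have hj := j.2
    have hi := i.2
    -- Slot `j` of a context lies `j + 1` steps back; `j < k ≤ i < n` keeps the natural subtractions
    -- from truncating.
    have := h ⟨(i : ℕ) - 1 - j, by omega⟩ ⟨n - 1 - j, by omega⟩ (by simp only; omega)
      (by simp only; omega) (by simp only; omega)
    convert this using 3 <;> push_cast <;> omega
  · have := congrFun h ⟨(i : ℕ) - 1 - a, by omega⟩
    rw [context_shiftPath, context_shiftPath] at this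
    convert this using 3 <;> simp only <;> omega

/-- The sum of `φ` over the observations among `x 1, …, x n` with context `s`, counted once the
history has length at least `k`. -/
def contextSum (q : E → ℕ) (k : ℕ) (x : ℤ → E) (s : Fin k → ℕ) (φ : E → ℝ) (n : ℕ) : ℝ :=
  ∑ i ∈ Finset.range n,
    if k ≤ i ∧ context q k (shiftPath (i + 1) x) = s then φ (x (i + 1)) else 0

theorem sum_matchingTimes (q : E → ℕ) (k : ℕ) {n : ℕ} (x : ℤ → E) (φ : E → ℝ) :
    ∑ i ∈ matchingTimes q k (fun j : Fin n => x ((j : ℕ) + 1)), φ (x ((i : ℕ) + 1))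
      = contextSum q k x (context q k (shiftPath (n + 1) x)) φ n := by
  have h : matchingTimes q k (fun j : Fin n => x ((j : ℕ) + 1)) = Finset.univ.filter fun i : Fin n
      => k ≤ (i : ℕ) ∧ context q k (shiftPath (i + 1) x) = context q k (shiftPath (n + 1) x) := by
    ext i
    simp [mem_matchingTimes_iff]
  rw [h, Finset.sum_filter, contextSum, ← Fin.sum_univ_eq_sum_range fun i => if k ≤ i ∧
    context q k (shiftPath (i + 1) x) = context q k (shiftPath (n + 1) x)
    then φ (x ((i : ℕ) + 1)) else 0]

theorem card_matchingTimes (q : E → ℕ) (k : ℕ) {n : ℕ} (x : ℤ → E) :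
    ((matchingTimes q k (fun j : Fin n => x ((j : ℕ) + 1))).card : ℝ)
      = contextSum q k x (context q k (shiftPath (n + 1) x)) (fun _ => 1) n := by
  rw [← sum_matchingTimes]
  simp

/-- The restriction `k ≤ i` alters only finitely many terms, which Cesàro averaging forgets. -/
theorem tendsto_contextSum (q : E → ℕ) (k : ℕ) (x : ℤ → E) (s : Fin k → ℕ) (φ : E → ℝ) {a : ℝ}
    (h : Tendsto (fun n : ℕ => (1 / (n : ℝ)) * ∑ i ∈ Finset.range n,
      if context q k (shiftPath (i + 1) x) = s then φ (x (i + 1)) else 0) atTop (𝓝 a)) :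
    Tendsto (fun n : ℕ => (1 / (n : ℝ)) * contextSum q k x s φ n) atTop (𝓝 a) := by
  have h1 : Tendsto (fun n : ℕ => (n : ℝ)⁻¹ * ∑ i ∈ Finset.range n,
      ((if k ≤ i ∧ context q k (shiftPath (i + 1) x) = s then φ (x (i + 1)) else 0)
        - if context q k (shiftPath (i + 1) x) = s then φ (x (i + 1)) else 0)) atTop (𝓝 0) := by
    apply Tendsto.cesaro
    refine tendsto_const_nhds.congr' ?_
    filter_upwards [eventually_ge_atTop k] with i hi
    simp [hi]
  have h2 := h.add h1
  rw [add_zero] at h2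
  refine h2.congr fun n => ?_
  rw [contextSum, Finset.sum_sub_distrib]
  ring

theorem contextSum_sub (q : E → ℕ) (k : ℕ) (x : ℤ → E) (s : Fin k → ℕ) (φ ψ : E → ℝ) (n : ℕ) :
    contextSum q k x s φ n - contextSum q k x s ψ n
      = contextSum q k x s (fun z => φ z - ψ z) n := by
  rw [contextSum, contextSum, contextSum, ← Finset.sum_sub_distrib]
  refine Finset.sum_congr rfl fun i _ => ?_
  split_ifs <;> simp

theorem contextSum_one_nonneg (q : E → ℕ) (k : ℕ) (x : ℤ → E) (s : Fin k → ℕ) (n : ℕ) :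
    0 ≤ contextSum q k x s (fun _ => 1) n :=
  Finset.sum_nonneg fun i _ => by split_ifs <;> norm_num

theorem abs_contextSum_le (q : E → ℕ) (k : ℕ) (x : ℤ → E) (s : Fin k → ℕ) {φ : E → ℝ} {ε : ℝ}
    (h : ∀ z, |φ z| ≤ ε) (n : ℕ) :
    |contextSum q k x s φ n| ≤ ε * contextSum q k x s (fun _ => 1) n := by
  rw [contextSum, contextSum, Finset.mul_sum]
  refine (Finset.abs_sum_le_sum_abs _ _).trans (Finset.sum_le_sum fun i _ => ?_)
  split_ifs
  · simpa using h _
  · simp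

end Paths

/-! ### Empirical means over the observations with a given context. -/

section ContextMean

variable {V E : Type*} [NormedAddCommGroup V] [NormedSpace ℝ V] [MeasurableSpace E]

/-- The empirical mean of an integrand over the past observations with context `s`. -/
noncomputable def contextMean (q : E → ℕ) (k : ℕ) (x : ℤ → E) (s : Fin k → ℕ) (u : V → E → ℝ)
    (n : ℕ) (y : V) :
    ℝ :=
  (contextSum q k x s (fun _ => 1) n)⁻¹ * contextSum q k x s (u y) n

variable {Y : Set V} {u : V → E → ℝ}

theorem IsIntegrand.equicont_contextMean (hu : IsIntegrand Y u) (q : E → ℕ) (k : ℕ) (x : ℤ → E)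
    (s : Fin k → ℕ) : UnifEquicontOn Y (contextMean q k x s u) := by
  intro ε hε
  obtain ⟨δ, hδ, h⟩ := hu.equicont ε hε
  refine ⟨δ, hδ, fun y hy z hz hyz n => ?_⟩
  rw [contextMean, contextMean, ← mul_sub, contextSum_sub, abs_mul, abs_inv,
    abs_of_nonneg (contextSum_one_nonneg q k x s n)]
  have h1 := abs_contextSum_le q k x s (fun w => h y hy z hz hyz w) n
  -- With no observation in this context, `0⁻¹ = 0` makes the mean vanish and the modulus holds
  -- trivially.
  rcases (contextSum_one_nonneg q k x s n).eq_or_lt with h0 | h0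
  · rw [← h0]; simpa using hε.le
  · rw [inv_mul_le_iff₀ h0, mul_comm]; exact h1

theorem IsIntegrand.convexOn_contextMean (hY : Convex ℝ Y) (hu : IsIntegrand Y u) (q : E → ℕ)
    (k : ℕ) (x : ℤ → E) (s : Fin k → ℕ) (n : ℕ) : ConvexOn ℝ Y (contextMean q k x s u n) := by
  have h0 := inv_nonneg.2 (contextSum_one_nonneg q k x s n)
  have h1 : ConvexOn ℝ Y fun y => contextSum q k x s (u y) n := by
    refine ⟨hY, fun y hy z hz a b ha hb hab => ?_⟩
    simp only [contextSum, smul_eq_mul]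
    rw [Finset.mul_sum, Finset.mul_sum, ← Finset.sum_add_distrib]
    refine Finset.sum_le_sum fun i _ => ?_
    split_ifs
    · exact (hu.convex _).2 hy hz ha hb hab
    · simp
  exact h1.smul h0

/-- The mean is a ratio of two ergodic averages: the factors `1 / n` cancel, and so does the context
frequency `w ≠ 0` in the limit. -/
theorem tendstoUniformlyOn_contextMean (hY : IsCompact Y) (hu : IsIntegrand Y u) {D : Set V}
    (hDY : D ⊆ Y) (hD : Y ⊆ closure D) (q : E → ℕ) (k : ℕ) (x : ℤ → E) (s : Fin k → ℕ)
    (P : Measure E) [IsProbabilityMeasure P] {w : ℝ} (hw : w ≠ 0)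
    (hcount : Tendsto (fun n : ℕ => (1 / (n : ℝ)) * contextSum q k x s (fun _ => 1) n) atTop (𝓝 w))
    (hsum : ∀ y ∈ D, Tendsto (fun n : ℕ => (1 / (n : ℝ)) * contextSum q k x s (u y) n) atTop
      (𝓝 (w * ∫ z, u y z ∂P))) :
    TendstoUniformlyOn (contextMean q k x s u) (fun y => ∫ z, u y z ∂P) atTop Y := by
  refine tendstoUniformlyOn_of_dense hY hDY hD (hu.equicont_contextMean q k x s)
    (hu.equicont_integral fun _ : Unit => P) fun y hy => ?_
  have h1 := (hcount.inv₀ hw).mul (hsum y hy)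
  rw [inv_mul_cancel_left₀ hw] at h1
  refine h1.congr' ?_
  filter_upwards [eventually_gt_atTop 0] with n hn
  have : (n : ℝ) ≠ 0 := by positivity
  rw [contextMean, mul_inv, one_div, inv_inv]
  field_simp

/-- Uniformity in `x` is the point: closeness of predictions becomes closeness of losses whatever
outcome follows. -/
theorem IsIntegrand.exists_abs_lagrangian_sub_le {c : V → E → ℝ} (hu : IsIntegrand Y u)
    (hc : IsIntegrand Y c)
    (γ L : ℝ) {ε : ℝ} (hε : 0 < ε) : ∃ δ > 0, ∀ p r : V × ℝ, p.1 ∈ Y → r.1 ∈ Y →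
      p.2 ∈ Set.Icc 0 L → dist p r < δ → ∀ x,
        |(u p.1 x + p.2 * (c p.1 x - γ)) - (u r.1 x + r.2 * (c r.1 x - γ))| ≤ ε := by
  obtain ⟨C, hC⟩ := hc.bounded
  obtain ⟨δ₁, hδ₁, h₁⟩ := hu.equicont (ε / 3) (by positivity)
  obtain ⟨δ₂, hδ₂, h₂⟩ := hc.equicont (ε / (3 * (1 + |L|))) (by positivity)
  have hη : 0 < ε / (3 * (1 + |C| + |γ|)) := by positivity
  refine ⟨min (min δ₁ δ₂) (ε / (3 * (1 + |C| + |γ|))), lt_min (lt_min hδ₁ hδ₂) hη, ?_⟩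
  intro p r hp hr hpL hpr x
  rw [Prod.dist_eq, max_lt_iff] at hpr
  have hd1 : dist p.1 r.1 < min δ₁ δ₂ := hpr.1.trans_le (min_le_left _ _)
  have hd2 : dist p.2 r.2 < ε / (3 * (1 + |C| + |γ|)) := hpr.2.trans_le (min_le_right _ _)
  have e1 := abs_le.1 (h₁ _ hp _ hr (hd1.trans_le (min_le_left _ _)) x)
  have e2 := h₂ _ hp _ hr (hd1.trans_le (min_le_right _ _)) x
  rw [Real.dist_eq] at hd2
  have b1 : |p.2 * (c p.1 x - c r.1 x)| ≤ ε / 3 := by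
    rw [abs_mul]
    calc _ ≤ (1 + |L|) * (ε / (3 * (1 + |L|))) := by
          refine mul_le_mul ?_ e2 (abs_nonneg _) (by positivity)
          rw [abs_of_nonneg hpL.1]
          linarith [hpL.2, le_abs_self L]
      _ = ε / 3 := by field_simp
  have b2 : |(p.2 - r.2) * (c r.1 x - γ)| ≤ ε / 3 := by
    rw [abs_mul, mul_comm]
    calc _ ≤ (1 + |C| + |γ|) * (ε / (3 * (1 + |C| + |γ|))) := by
          refine mul_le_mul ?_ hd2.le (abs_nonneg _) (by positivity)
          have := abs_sub (c r.1 x) γ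
          linarith [hC _ hr x, le_abs_self C]
      _ = ε / 3 := by field_simp
  have b1' := abs_le.1 b1
  have b2' := abs_le.1 b2
  rw [abs_le]
  constructor <;> linarith

end ContextMean

/-! ### The average loss of an expert along a fixed path. -/

section Loss

variable {d m : ℕ}

/-- Averaging leaves `γ` and the penalty unchanged, which is where a nonempty matching set is
needed. -/
theorem empLoss_eq_saddleFun (u c : EuclideanSpace ℝ (Fin m) → EuclideanSpace ℝ (Fin d) → ℝ) (γ : ℝ)
    (q : ℕ → EuclideanSpace ℝ (Fin d) → ℕ) (k h n : ℕ) (x : ℤ → EuclideanSpace ℝ (Fin d))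
    (hne : matchingTimes (q h) k (fun j : Fin n => x ((j : ℕ) + 1)) ≠ ∅) :
    empLoss u c γ q k h (fun j : Fin n => x ((j : ℕ) + 1)) =
      saddleFun (contextMean (q h) k x (context (q h) k (shiftPath (n + 1) x)) u n)
        (fun y => contextMean (q h) k x (context (q h) k (shiftPath (n + 1) x)) c n y - γ)
        (1 / ((n + 1 : ℕ) : ℝ) + 1 / (h : ℝ) + 1 / (k : ℝ)) := by
  funext y lam
  have hcard : ((matchingTimes (q h) k (fun j : Fin n => x ((j : ℕ) + 1))).card : ℝ) ≠ 0 := by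
    rw [Nat.cast_ne_zero, Finset.card_ne_zero]
    exact Finset.nonempty_iff_ne_empty.2 hne
  simp only [empLoss, regLoss, lagLoss, saddleFun, contextMean, ← sum_matchingTimes]
  simp only [Finset.sum_add_distrib, ← Finset.mul_sum, Finset.sum_sub_distrib, Finset.sum_const,
    nsmul_eq_mul]
  field_simp

variable {Y : Set (EuclideanSpace ℝ (Fin m))} {u c : EuclideanSpace ℝ (Fin m) →
    EuclideanSpace ℝ (Fin d) → ℝ}

/-- Along a path on which all the relevant empirical means converge, the average loss of a
histogram expert converges to that of the limiting, context dependent, saddle strategy. -/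
theorem IsHistogramExpert.tendsto_avgLoss {D : ℝ} (hY : IsCompact Y) (hYc : Convex ℝ Y)
    (hne : Y.Nonempty) (hu : IsIntegrand Y u) (hc : IsIntegrand Y c) {γ L : ℝ} (hL : 0 ≤ L)
    {y₀ : EuclideanSpace ℝ (Fin m)} {lam₀ : ℝ} {q : ℕ → EuclideanSpace ℝ (Fin d) → ℕ} {k h : ℕ}
    (hk : 0 < k) (hq : (Set.range (q h)).Finite)
    {G : (n : ℕ) → (Fin n → EuclideanSpace ℝ (Fin d)) → EuclideanSpace ℝ (Fin m) × ℝ}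
    (hG : IsHistogramExpert D Y u c γ L y₀ lam₀ q k h G)
    {x : ℤ → EuclideanSpace ℝ (Fin d)} (hx : ∀ i, x i ∈ cube d D)
    {Q : Set (EuclideanSpace ℝ (Fin m))} (hQY : Q ⊆ Y) (hQ : Y ⊆ closure Q)
    (P : (Fin k → ℕ) → Measure (EuclideanSpace ℝ (Fin d))) [∀ s, IsProbabilityMeasure (P s)]
    {p : (Fin k → ℕ) → EuclideanSpace ℝ (Fin m) × ℝ}
    (hp : ∀ s, IsSaddle Y (Set.Icc 0 L) (saddleFun (fun y => ∫ z, u y z ∂(P s))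
      (fun y => ∫ z, c y z ∂(P s) - γ) (1 / (h : ℝ) + 1 / (k : ℝ))) (p s))
    {w : (Fin k → ℕ) → ℝ} {a : ℝ} (hw : ∀ n : ℕ, w (context (q h) k (shiftPath (n + 1) x)) ≠ 0)
    (hcount : ∀ s, Tendsto (fun n : ℕ => (1 / (n : ℝ)) * contextSum (q h) k x s (fun _ => 1) n)
      atTop (𝓝 (w s)))
    (husum : ∀ s, ∀ y ∈ Q, Tendsto (fun n : ℕ => (1 / (n : ℝ)) * contextSum (q h) k x s (u y) n)
      atTop (𝓝 (w s * ∫ z, u y z ∂(P s))))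
    (hcsum : ∀ s, ∀ y ∈ Q, Tendsto (fun n : ℕ => (1 / (n : ℝ)) * contextSum (q h) k x s (c y) n)
      atTop (𝓝 (w s * ∫ z, c y z ∂(P s))))
    (ha : Tendsto (fun n : ℕ => (1 / (n : ℝ)) * ∑ i ∈ Finset.range n,
      lagLoss u c γ (p (context (q h) k (shiftPath (i + 1) x))).1
        (p (context (q h) k (shiftPath (i + 1) x))).2 (x (i + 1))) atTop (𝓝 a)) :
    Tendsto (avgLoss u c γ G x) atTop (𝓝 a) := by
  set σ : ℕ → Fin k → ℕ := fun n => context (q h) k (shiftPath (n + 1) x) with hσ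
  set g : ℕ → EuclideanSpace ℝ (Fin m) × ℝ := fun n => G n fun j => x ((j : ℕ) + 1) with hg
  have hρ : (0 : ℝ) < 1 / (h : ℝ) + 1 / (k : ℝ) := by positivity
  -- Limits are taken along the rounds with context `s` only. A nonzero frequency makes the matching
  -- set eventually nonempty, so the default pair is no longer played.
  have hsaddle : ∀ s, w s ≠ 0 → ∀ᶠ n : ℕ in atTop ⊓ 𝓟 {n : ℕ | σ n = s},
      IsSaddle Y (Set.Icc 0 L) (saddleFun (contextMean (q h) k x s u n)
        (fun y => contextMean (q h) k x s c n y - γ)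
        (1 / ((n + 1 : ℕ) : ℝ) + 1 / (h : ℝ) + 1 / (k : ℝ))) (g n) := by
    intro s hs
    rw [eventually_inf_principal]
    filter_upwards [(hcount s).eventually_ne hs] with n hn hns
    have hns' : context (q h) k (shiftPath (n + 1) x) = s := hns
    have hB : matchingTimes (q h) k (fun j : Fin n => x ((j : ℕ) + 1)) ≠ ∅ := by
      rintro h0
      apply hn
      rw [← hns', ← card_matchingTimes, h0]
      simp
    have h1 := (hG n _ fun i => hx _).2 hB
    rw [empLoss_eq_saddleFun u c γ q k h n x hB, hns'] at h1
    exact (isMinimaxPair_saddleFun_iff hY hne hL (hu.convexOn_contextMean hYc _ _ _ _ _)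
      ((hc.convexOn_contextMean hYc _ _ _ _ _).sub (concaveOn_const γ hYc))
      ((hu.equicont_contextMean _ _ _ _).continuousOn _)
      (((hc.equicont_contextMean _ _ _ _).continuousOn _).sub continuousOn_const)
      (by positivity)).1 h1
  have hconv : ∀ s, w s ≠ 0 → Tendsto g (atTop ⊓ 𝓟 {n : ℕ | σ n = s}) (𝓝 (p s)) := by
    intro s hs
    have hmono : ∀ {F : ℕ → EuclideanSpace ℝ (Fin m) → ℝ} {f : EuclideanSpace ℝ (Fin m) → ℝ},
      TendstoUniformlyOn F f atTop Y →
        TendstoUniformlyOn F f (atTop ⊓ 𝓟 {n : ℕ | σ n = s}) Y := 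
      fun hF v hv => (hF v hv).filter_mono inf_le_left
    have hU := tendstoUniformlyOn_contextMean hY hu hQY hQ (q h) k x s (P s) hs (hcount s) (husum s)
    have hC := tendstoUniformlyOn_contextMean hY hc hQY hQ (q h) k x s (P s) hs (hcount s) (hcsum s)
    have hC' : TendstoUniformlyOn (fun n y => contextMean (q h) k x s c n y - γ)
        (fun y => ∫ z, c y z ∂(P s) - γ) atTop Y := by
      rw [Metric.tendstoUniformlyOn_iff] at hC ⊢
      simpa only [dist_sub_right] using hC
    have hr : Tendsto (fun n : ℕ => 1 / ((n + 1 : ℕ) : ℝ) + 1 / (h : ℝ) + 1 / (k : ℝ)) atTop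
        (𝓝 (1 / (h : ℝ) + 1 / (k : ℝ))) := by
      have := (tendsto_one_div_add_atTop_nhds_zero_nat (𝕜 := ℝ)).add_const
        (1 / (h : ℝ) + 1 / (k : ℝ))
      rw [zero_add] at this
      refine this.congr fun n => ?_
      push_cast; ring
    exact tendsto_saddle hY (hmono hU) (hmono hC') (hr.mono_left inf_le_left) hρ
      (hu.convexOn_integral hYc _) ((hc.convexOn_integral hYc _).sub (concaveOn_const γ hYc))
      (hsaddle s hs) (hp s)
  -- Finitely many contexts occur, so convergence within each of them gives convergence along all
  -- rounds.
  have hfin : (Set.range σ).Finite := by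
    refine (Set.Finite.pi' fun _ : Fin k => hq).subset ?_
    rintro _ ⟨n, rfl⟩ j
    exact ⟨_, rfl⟩
  have hclose : ∀ δ > 0, ∀ᶠ n in atTop, (g n).1 ∈ Y ∧ (g n).2 ∈ Set.Icc 0 L ∧
      dist (g n) (p (σ n)) < δ := by
    intro δ hδ
    have h1 : ∀ᶠ n in atTop, ∀ s ∈ Set.range σ, σ n = s → (g n).1 ∈ Y ∧ (g n).2 ∈ Set.Icc 0 L ∧
        dist (g n) (p s) < δ := by
      rw [eventually_all_finite hfin]
      rintro _ ⟨j, rfl⟩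
      have h2 := (hsaddle _ (hw j)).and (Metric.tendsto_nhds.1 (hconv _ (hw j)) δ hδ)
      rw [eventually_inf_principal] at h2
      filter_upwards [h2] with n hn hns
      have h3 := hn hns
      exact ⟨h3.1.1, h3.1.2.1, h3.2⟩
    filter_upwards [h1] with n hn using hn _ ⟨n, rfl⟩ rfl
  have hdiff : Tendsto (fun n : ℕ => lagLoss u c γ (g n).1 (g n).2 (x (n + 1))
      - lagLoss u c γ (p (σ n)).1 (p (σ n)).2 (x (n + 1))) atTop (𝓝 0) := by
    rw [Metric.tendsto_nhds]
    intro ε hε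
    obtain ⟨δ, hδ, hδ'⟩ := hu.exists_abs_lagrangian_sub_le hc γ L (by positivity : 0 < ε / 2)
    filter_upwards [hclose δ hδ] with n hn
    have := hδ' (g n) (p (σ n)) hn.1 (hp _).1 hn.2.1 hn.2.2 (x (n + 1))
    rw [Real.dist_eq, sub_zero]
    exact this.trans_lt (half_lt_self hε)
  have h1 := ha.add hdiff.cesaro
  rw [add_zero] at h1
  refine h1.congr fun n => ?_
  rw [avgLoss, Finset.sum_sub_distrib]
  simp only [hσ, hg]
  ring

end Loss

/-! ### Time averages of a stationary ergodic process. -/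

section Stationary

theorem IsStationaryErgodic.measurable_path {d : ℕ} {Ω : Type*} [MeasurableSpace Ω]
    {μ : Measure Ω} {X : ℤ → Ω → EuclideanSpace ℝ (Fin d)} (hX : IsStationaryErgodic μ X) :
    Measurable fun ω i => X i ω :=
  measurable_pi_lambda _ hX.measurable

variable {d : ℕ} {Ω : Type*} [MeasurableSpace Ω] {μ : Measure Ω} [IsProbabilityMeasure μ]
  {X : ℤ → Ω → EuclideanSpace ℝ (Fin d)}

theorem iterate_shift {E : Type*} (n : ℕ) (x : ℤ → E) :
    (fun (x : ℤ → E) (i : ℤ) => x (i + 1))^[n] x = shiftPath n x := by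
  induction n generalizing x with
  | zero => funext i; simp [shiftPath]
  | succ n ih =>
    rw [Function.iterate_succ_apply, ih]
    funext i
    simp only [shiftPath]
    congr 1
    push_cast
    ring

/-- Time averages along a stationary ergodic process converge almost surely. -/
theorem IsStationaryErgodic.ae_tendsto_average (hX : IsStationaryErgodic μ X)
    {ψ : (ℤ → EuclideanSpace ℝ (Fin d)) → ℝ} (hψ : Measurable ψ) {C : ℝ} (hC : ∀ x, |ψ x| ≤ C) :
    ∀ᵐ ω ∂μ, Tendsto (fun n : ℕ => (1 / (n : ℝ)) * ∑ i ∈ Finset.range n,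
      ψ (shiftPath (i + 1) fun j => X j ω)) atTop (𝓝 (∫ ω, ψ (fun j => X j ω) ∂μ)) := by
  have hm := hX.measurable_path
  have : IsProbabilityMeasure (μ.map fun ω i => X i ω) :=
    Measure.isProbabilityMeasure_map hm.aemeasurable
  set T := fun (x : ℤ → EuclideanSpace ℝ (Fin d)) (i : ℤ) => x (i + 1) with hT
  have hTm : Measurable T := hX.ergodic.measurable
  -- The sums start at shift `1`, so Birkhoff's theorem is applied to `ψ ∘ T`, whose mean is that of
  -- `ψ` by invariance.
  have h1 := ae_of_ae_map hm.aemeasurable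
    (ae_tendsto_birkhoffSum_div hX.ergodic (hψ.comp hTm) fun x => hC (T x))
  have h2 : ∫ x, (ψ ∘ T) x ∂(μ.map fun ω i => X i ω) = ∫ ω, ψ (fun j => X j ω) ∂μ := by
    rw [← integral_map hm.aemeasurable hψ.aestronglyMeasurable]
    have h3 := integral_map (μ := μ.map fun ω i => X i ω) hTm.aemeasurable
      (f := ψ) hψ.aestronglyMeasurable
    rw [hX.ergodic.map_eq] at h3
    exact h3.symm
  filter_upwards [h1] with ω hω
  rw [h2] at hω
  refine hω.congr fun n => ?_
  congr 1
  refine Finset.sum_congr rfl fun i _ => ?_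
  rw [Function.comp_apply, ← Function.iterate_succ_apply' T, iterate_shift]

/-- Almost surely, only events of positive probability occur along the path, if these events form
a countable partition. -/
theorem IsStationaryErgodic.ae_forall_measure_fiber_ne_zero (hX : IsStationaryErgodic μ X)
    {S : Type*} [Countable S] [MeasurableSpace S] [MeasurableSingletonClass S]
    {f : (ℤ → EuclideanSpace ℝ (Fin d)) → S} (hf : Measurable f) :
    ∀ᵐ ω ∂μ, ∀ n : ℕ,
      μ.real {ω' | f (fun j => X j ω') = f (shiftPath (n + 1) fun j => X j ω)} ≠ 0 := by
  have hm := hX.measurable_path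
  set T := fun (x : ℤ → EuclideanSpace ℝ (Fin d)) (i : ℤ) => x (i + 1) with hT
  set ν := μ.map fun ω i => X i ω with hν
  have h1 : ∀ᵐ x ∂ν, μ.real {ω' | f (fun j => X j ω') = f x} ≠ 0 := by
    have h2 : ∀ s : S, ∀ᵐ x ∂ν, f x = s → μ.real {ω' | f (fun j => X j ω') = s} ≠ 0 := by
      intro s
      by_cases hs : μ.real {ω' | f (fun j => X j ω') = s} = 0
      · rw [measureReal_eq_zero_iff] at hs
        have h3 : ν (f ⁻¹' {s}) = 0 := by
          rw [hν, Measure.map_apply hm (hf (measurableSet_singleton s))]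
          exact hs
        filter_upwards [measure_eq_zero_iff_ae_notMem.1 h3] with x hx hxs
        exact absurd hxs hx
      · exact Eventually.of_forall fun x _ => hs
    filter_upwards [ae_all_iff.2 h2] with x hx using hx _ rfl
  rw [ae_all_iff]
  intro n
  have h2 := (hX.ergodic.toMeasurePreserving.iterate (n + 1)).quasiMeasurePreserving.ae h1
  filter_upwards [ae_of_ae_map hm.aemeasurable h2] with ω hω
  rwa [iterate_shift] at hω

theorem measurable_context {E : Type*} [MeasurableSpace E] {q : E → ℕ} (hq : Measurable q)
    (k : ℕ) : Measurable (context q k) :=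
  measurable_pi_lambda _ fun _ => hq.comp (measurable_pi_apply _)

end Stationary

/-! ### The almost sure limit of one histogram expert. -/

section ExpertLimit

variable {d m : ℕ} {Ω : Type*} [MeasurableSpace Ω] {μ : Measure Ω} [IsProbabilityMeasure μ]
  {X : ℤ → Ω → EuclideanSpace ℝ (Fin d)} {Y : Set (EuclideanSpace ℝ (Fin m))}
  {u c : EuclideanSpace ℝ (Fin m) → EuclideanSpace ℝ (Fin d) → ℝ}

/-- The regularized conditional Lagrangian under the law `P`. -/
noncomputable def meanLagrangian
    (u c : EuclideanSpace ℝ (Fin m) → EuclideanSpace ℝ (Fin d) → ℝ) (γ ρ : ℝ)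
    (P : Measure (EuclideanSpace ℝ (Fin d))) : EuclideanSpace ℝ (Fin m) → ℝ → ℝ :=
  saddleFun (fun y => ∫ z, u y z ∂P) (fun y => ∫ z, c y z ∂P - γ) ρ

theorem IsIntegrand.exists_abs_lagLoss_le (hu : IsIntegrand Y u) (hc : IsIntegrand Y c)
    (γ L : ℝ) : ∃ C, ∀ y ∈ Y, ∀ lam ∈ Set.Icc 0 L, ∀ x, |lagLoss u c γ y lam x| ≤ C := by
  obtain ⟨A, hA⟩ := hu.bounded
  obtain ⟨B, hB⟩ := hc.bounded
  refine ⟨A + L * (B + |γ|), fun y hy lam hlam x => ?_⟩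
  rw [lagLoss]
  refine (abs_add_le _ _).trans (add_le_add (hA y hy x) ?_)
  rw [abs_mul, abs_of_nonneg hlam.1]
  exact mul_le_mul hlam.2 ((abs_sub _ _).trans (by linarith [hB y hy x])) (abs_nonneg _)
    (hlam.1.trans hlam.2)

theorem integral_lagLoss (hu : IsIntegrand Y u) (hc : IsIntegrand Y c) (γ : ℝ)
    (P : Measure (EuclideanSpace ℝ (Fin d))) [IsProbabilityMeasure P]
    {y : EuclideanSpace ℝ (Fin m)} (hy : y ∈ Y) (lam : ℝ) :
    ∫ x, lagLoss u c γ y lam x ∂P = meanLagrangian u c γ 0 P y lam := by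
  have h1 := hu.integrable P hy
  have h2 : Integrable (fun x => c y x - γ) P := (hc.integrable P hy).sub (integrable_const γ)
  simp only [lagLoss, meanLagrangian, saddleFun]
  rw [integral_add h1 (h2.const_mul lam), integral_const_mul,
    integral_sub (hc.integrable P hy) (integrable_const γ)]
  simp

theorem measurable_lagLoss_comp (hu : IsIntegrand Y u) (hc : IsIntegrand Y c) (γ : ℝ)
    {S : Type*} [Countable S] [MeasurableSpace S] [MeasurableSingletonClass S]
    {p : S → EuclideanSpace ℝ (Fin m) × ℝ} (hp : ∀ s, (p s).1 ∈ Y) :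
    Measurable fun z : S × EuclideanSpace ℝ (Fin d) => lagLoss u c γ (p z.1).1 (p z.1).2 z.2 := by
  refine measurable_from_prod_countable_right fun s => ?_
  exact (hu.measurable _ (hp s)).add (((hc.measurable _ (hp s)).sub_const γ).const_mul (p s).2)

/-- Conditioning on `Z` freezes the strategy. The loss incurred carries no regularization, hence the
weight `0`, although the strategy may come from a regularized problem. -/
theorem integral_lagLoss_context (hu : IsIntegrand Y u) (hc : IsIntegrand Y c) {γ L : ℝ}
    {S : Type*} [Countable S] [MeasurableSpace S] [MeasurableSingletonClass S]
    {p : S → EuclideanSpace ℝ (Fin m) × ℝ} (hp : ∀ s, (p s).1 ∈ Y) (hpL : ∀ s, (p s).2 ∈ Set.Icc 0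
    L)
    {Z : Ω → S} (hZ : Measurable Z) {W : Ω → EuclideanSpace ℝ (Fin d)} (hW : Measurable W) :
    ∫ ω, lagLoss u c γ (p (Z ω)).1 (p (Z ω)).2 (W ω) ∂μ =
      ∫ ω, meanLagrangian u c γ 0 (condDistrib W Z μ (Z ω)) (p (Z ω)).1 (p (Z ω)).2 ∂μ := by
  obtain ⟨C, hC⟩ := hu.exists_abs_lagLoss_le hc γ L
  rw [integral_condDistrib_eq hZ hW (measurable_lagLoss_comp hu hc γ hp)
    (fun ω => hC _ (hp _) _ (hpL _) _)]
  simp only [integral_lagLoss hu hc γ _ (hp _)]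

/-- This writes the Birkhoff limit of a context sum as frequency times conditional mean, the form
that `tendstoUniformlyOn_contextMean` takes. -/
theorem integral_ite_context {V E : Type*} [NormedAddCommGroup V] [NormedSpace ℝ V]
    [MeasurableSpace E] [StandardBorelSpace E] [Nonempty E] {Y : Set V} {u : V → E → ℝ}
    (hu : IsIntegrand Y u) {S : Type*} [DecidableEq S] [Countable S] [MeasurableSpace S]
    [MeasurableSingletonClass S] {Z : Ω → S} (hZ : Measurable Z) {W : Ω → E} (hW : Measurable W)
    (s : S) {y : V} (hy : y ∈ Y) :
    ∫ ω, (if Z ω = s then u y (W ω) else 0) ∂μ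
      = μ.real {ω | Z ω = s} * ∫ x, u y x ∂(condDistrib W Z μ s) := by
  obtain ⟨C, hC⟩ := hu.bounded
  have hF : Measurable fun z : S × E => if z.1 = s then u y z.2 else 0 := by
    refine measurable_from_prod_countable_right fun t => ?_
    by_cases ht : t = s
    · simpa [ht] using hu.measurable y hy
    · simp [ht]
  have h1 := integral_condDistrib_eq (μ := μ) hZ hW hF (C := C) fun ω => by
    simp only
    split_ifs
    · exact hC y hy _
    · simpa using (abs_nonneg _).trans (hC y hy (W ω))
  simp only at h1
  rw [h1]
  have h2 : ∀ ω, ∫ x, (if Z ω = s then u y x else 0) ∂(condDistrib W Z μ (Z ω))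
      = Set.indicator {ω | Z ω = s} (fun _ => ∫ x, u y x ∂(condDistrib W Z μ s)) ω := by
    intro ω
    by_cases h : Z ω = s
    · rw [Set.indicator_of_mem (show ω ∈ {ω | Z ω = s} from h)]
      simp [h]
    · rw [Set.indicator_of_notMem (show ω ∉ {ω | Z ω = s} from h)]
      simp [h]
  have h3 : MeasurableSet {ω | Z ω = s} := hZ (measurableSet_singleton s)
  simp only [h2]
  rw [integral_indicator h3, setIntegral_const, smul_eq_mul]

/-- Almost surely, the average loss of the histogram expert `(k, h)` converges to the expected
loss of the saddle strategy for the conditional law given the context. -/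
theorem IsHistogramExpert.ae_tendsto_avgLoss {D : ℝ} (hY : IsCompact Y) (hYc : Convex ℝ Y)
    (hne : Y.Nonempty) (hu : IsIntegrand Y u) (hc : IsIntegrand Y c) {γ L : ℝ} (hL : 0 ≤ L)
    {y₀ : EuclideanSpace ℝ (Fin m)} {lam₀ : ℝ} {q : ℕ → EuclideanSpace ℝ (Fin d) → ℕ} {k h : ℕ}
    (hk : 0 < k) (hqm : Measurable (q h)) (hq : (Set.range (q h)).Finite)
    {G : (n : ℕ) → (Fin n → EuclideanSpace ℝ (Fin d)) → EuclideanSpace ℝ (Fin m) × ℝ}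
    (hG : IsHistogramExpert D Y u c γ L y₀ lam₀ q k h G)
    (hX : IsStationaryErgodic μ X) (hXD : ∀ i ω, X i ω ∈ cube d D)
    {p : (Fin k → ℕ) → EuclideanSpace ℝ (Fin m) × ℝ}
    (hp : ∀ s, IsSaddle Y (Set.Icc 0 L) (meanLagrangian u c γ (1 / (h : ℝ) + 1 / (k : ℝ))
      (condDistrib (X 0) (fun ω => context (q h) k fun i => X i ω) μ s)) (p s)) :
    ∀ᵐ ω ∂μ, Tendsto (avgLoss u c γ G fun i => X i ω) atTop
      (𝓝 (∫ ω, lagLoss u c γ (p (context (q h) k fun i => X i ω)).1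
        (p (context (q h) k fun i => X i ω)).2 (X 0 ω) ∂μ)) := by
  obtain ⟨Q, hQY, hQc, hQ⟩ := hY.isSeparable.exists_countable_dense_subset
  have hctx := measurable_context hqm k
  have hZ : Measurable fun ω => context (q h) k fun i => X i ω := hctx.comp hX.measurable_path
  have hfib : ∀ s, MeasurableSet {x : ℤ → EuclideanSpace ℝ (Fin d) | context (q h) k x = s} :=
    fun s => hctx (measurableSet_singleton s)
  have key : ∀ v : EuclideanSpace ℝ (Fin m) → EuclideanSpace ℝ (Fin d) → ℝ, IsIntegrand Y v →
      ∀ᵐ ω ∂μ, ∀ s, ∀ y ∈ Q, Tendsto (fun n : ℕ => (1 / (n : ℝ)) *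
        contextSum (q h) k (fun i => X i ω) s (v y) n) atTop
        (𝓝 (μ.real {ω | context (q h) k (fun i => X i ω) = s} *
          ∫ z, v y z ∂(condDistrib (X 0) (fun ω => context (q h) k fun i => X i ω) μ s))) := by
    intro v hv
    rw [ae_all_iff]
    intro s
    rw [ae_ball_iff hQc]
    intro y hy
    obtain ⟨C, hC⟩ := hv.bounded
    have h1 := hX.ae_tendsto_average
      (ψ := fun x => if context (q h) k x = s then v y (x 0) else 0)
      (Measurable.ite (hfib s) ((hv.measurable y (hQY hy)).comp (measurable_pi_apply 0))
        measurable_const) (C := C) fun x => by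
          split_ifs
          · exact hC y (hQY hy) _
          · simpa using (abs_nonneg _).trans (hC y (hQY hy) (x 0))
    rw [integral_ite_context hv hZ (hX.measurable 0) s (hQY hy)] at h1
    filter_upwards [h1] with ω hω
    apply tendsto_contextSum
    refine hω.congr fun n => ?_
    simp [shiftPath]
  have hcount : ∀ᵐ ω ∂μ, ∀ s, Tendsto (fun n : ℕ => (1 / (n : ℝ)) *
      contextSum (q h) k (fun i => X i ω) s (fun _ => 1) n) atTop
      (𝓝 (μ.real {ω | context (q h) k (fun i => X i ω) = s})) := by
    rw [ae_all_iff]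
    intro s
    have h1 := hX.ae_tendsto_average
      (ψ := fun x => if context (q h) k x = s then 1 else 0)
      (Measurable.ite (hfib s) measurable_const measurable_const) (C := 1) fun x => by
          split_ifs <;> simp
    have h2 : ∫ ω, (if context (q h) k (fun i => X i ω) = s then (1 : ℝ) else 0) ∂μ
        = μ.real {ω | context (q h) k (fun i => X i ω) = s} := by
      refine Eq.trans ?_ (integral_indicator_one (hZ (measurableSet_singleton s)))
      refine integral_congr_ae (Eventually.of_forall fun ω => ?_)
      simp [Set.indicator]
    rw [h2] at h1
    filter_upwards [h1] with ω hω
    exact tendsto_contextSum _ _ _ _ _ hω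
  obtain ⟨C, hC⟩ := hu.exists_abs_lagLoss_le hc γ L
  have hloss := hX.ae_tendsto_average
    (ψ := fun x => lagLoss u c γ (p (context (q h) k x)).1 (p (context (q h) k x)).2 (x 0))
    ((measurable_lagLoss_comp hu hc γ fun s => (hp s).1).comp
      (hctx.prodMk (measurable_pi_apply 0))) (C := C)
    fun x => hC _ (hp _).1 _ (hp _).2.1 _
  filter_upwards [key u hu, key c hc, hcount, hloss, hX.ae_forall_measure_fiber_ne_zero hctx]
    with ω h1 h2 h3 h4 h5
  refine hG.tendsto_avgLoss hY hYc hne hu hc hL hk hq (fun i => hXD i ω) hQY hQ _ hp h5 h3 h1 h2 ?_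
  refine h4.congr fun n => ?_
  simp [shiftPath]

end ExpertLimit

/-! ### σ-algebras generated by finite parts of a sequence. -/

section SigmaAlgebras

variable {Ω : Type*} {E : Type*} [mE : MeasurableSpace E]

theorem monotone_comap_fin (f : ℕ → Ω → E) :
    Monotone fun n => (MeasurableSpace.pi : MeasurableSpace (Fin n → E)).comap
      fun ω (j : Fin n) => f j ω := by
  intro n k hnk
  have h : (fun ω (j : Fin n) => f j ω) =
      (fun v (j : Fin n) => v (Fin.castLE hnk j)) ∘ fun ω (j : Fin k) => f j ω := rfl
  simp only
  rw [h, ← MeasurableSpace.comap_comp]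
  apply MeasurableSpace.comap_mono
  apply Measurable.comap_le
  exact measurable_pi_lambda _ fun j => measurable_pi_apply _

theorem iSup_comap_fin (f : ℕ → Ω → E) :
    ⨆ n, (MeasurableSpace.pi : MeasurableSpace (Fin n → E)).comap (fun ω (j : Fin n) => f j ω)
      = MeasurableSpace.pi.comap fun ω (j : ℕ) => f j ω := by
  apply le_antisymm
  · refine iSup_le fun n => ?_
    have h : (fun ω (j : Fin n) => f j ω) =
        (fun (v : ℕ → E) (j : Fin n) => v j) ∘ fun ω (j : ℕ) => f j ω := rfl
    rw [h, ← MeasurableSpace.comap_comp]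
    apply MeasurableSpace.comap_mono
    apply Measurable.comap_le
    exact measurable_pi_lambda _ fun j => measurable_pi_apply _
  · rw [← measurable_iff_comap_le]
    refine @measurable_pi_lambda _ _ _ (_) _ _ fun j => ?_
    refine Measurable.mono (ma := (MeasurableSpace.pi : MeasurableSpace (Fin (j + 1) → E)).comap
      fun ω (i : Fin (j + 1)) => f i ω) ?_ (le_iSup (fun n =>
      (MeasurableSpace.pi : MeasurableSpace (Fin n → E)).comap fun ω (i : Fin n) => f i ω) (j + 1))
      le_rfl
    exact (measurable_pi_apply (⟨j, j.lt_succ_self⟩ : Fin (j + 1))).comp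
      (comap_measurable fun ω (i : Fin (j + 1)) => f i ω)

/-- Since `g` determines `f`, every `f ⁻¹' B` is a union of fibers of `g`, so it is the preimage of
its own image, and every subset of `S` is measurable. -/
theorem comap_le_comap_of_factors {S : Type*} [MeasurableSpace S] [DiscreteMeasurableSpace S]
    {f g : Ω → S} (h : ∀ ω ω', g ω = g ω' → f ω = f ω') :
    MeasurableSpace.comap f inferInstance ≤ MeasurableSpace.comap g inferInstance := by
  rintro _ ⟨B, -, rfl⟩
  refine ⟨g '' (f ⁻¹' B), MeasurableSet.of_discrete, ?_⟩
  ext ω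
  constructor
  · rintro ⟨ω', hω', hg⟩
    have := h _ _ hg
    rwa [Set.mem_preimage, this] at hω'
  · exact fun hω => ⟨ω, hω, rfl⟩

end SigmaAlgebras

/-! ### Quantized observations generate the σ-algebra of the observations. -/

section Quantizer

variable {Ω E : Type*} [PseudoMetricSpace E] [MeasurableSpace E]
  {K : Set E} {q : ℕ → E → ℕ}

theorem IsRefiningQuantizer.monotone_comap (hq : IsRefiningQuantizer K q) {k : ℕ}
    {W : Ω → Fin k → E} (hW : ∀ ω j, W ω j ∈ K) :
    Monotone fun h => (MeasurableSpace.pi : MeasurableSpace (Fin k → ℕ)).comap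
      fun ω j => q h (W ω j) := by
  refine monotone_nat_of_le_succ fun h => comap_le_comap_of_factors fun ω ω' hω => ?_
  funext j
  exact hq.refines h _ (hW ω j) _ (hW ω' j) (congrFun hω j)

/-- Each coordinate is the limit of representatives of its cells, which are functions of the labels,
because the mesh tends to `0`. -/
theorem IsRefiningQuantizer.iSup_comap [BorelSpace E] (hq : IsRefiningQuantizer K q)
    (hqm : ∀ h, Measurable (q h))
    (hK : Bornology.IsBounded K) {k : ℕ} {W : Ω → Fin k → E} (hW : ∀ ω j, W ω j ∈ K) :
    ⨆ h, (MeasurableSpace.pi : MeasurableSpace (Fin k → ℕ)).comap (fun ω j => q h (W ω j))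
      = MeasurableSpace.pi.comap W := by
  apply le_antisymm
  · refine iSup_le fun h => ?_
    have h1 : (fun ω j => q h (W ω j)) = (fun (v : Fin k → E) j => q h (v j)) ∘ W := rfl
    rw [h1, ← MeasurableSpace.comap_comp]
    apply MeasurableSpace.comap_mono
    apply Measurable.comap_le
    exact measurable_pi_lambda _ fun j => (hqm h).comp (measurable_pi_apply _)
  · rw [← measurable_iff_comap_le]
    refine @measurable_pi_lambda _ _ _ (_) _ _ fun j => ?_
    rcases isEmpty_or_nonempty Ω with hΩ | ⟨⟨ω₀⟩⟩
    · exact fun s _ => by rw [Set.eq_empty_of_isEmpty ((fun ω => W ω j) ⁻¹' s)]; exact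
      @MeasurableSet.empty _ (_)
    have hr : ∀ h : ℕ, ∃ r : ℕ → E, ∀ x ∈ K, r (q h x) ∈ K ∧ q h (r (q h x)) = q h x := by
      intro h
      classical
      refine ⟨fun n => if hn : ∃ x ∈ K, q h x = n then hn.choose else W ω₀ j, fun x hx => ?_⟩
      have hn : ∃ x' ∈ K, q h x' = q h x := ⟨x, hx, rfl⟩
      simp only [dif_pos hn]
      exact hn.choose_spec
    choose r hr using hr
    refine @measurable_of_tendsto_metrizable Ω E (_) _ _ _ _ (fun h ω => r h (q h (W ω j)))
      (fun ω => W ω j) (fun h => ?_) ?_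
    · refine Measurable.mono
        (ma := (MeasurableSpace.pi : MeasurableSpace (Fin k → ℕ)).comap fun ω j => q h (W ω j)) ?_
        (le_iSup (fun h => (MeasurableSpace.pi : MeasurableSpace (Fin k → ℕ)).comap
          fun ω j => q h (W ω j)) h) le_rfl
      have h1 : Measurable fun v : Fin k → ℕ => r h (v j) :=
        (Measurable.of_discrete (f := r h)).comp (measurable_pi_apply j)
      exact h1.comp (comap_measurable fun ω j => q h (W ω j))
    · rw [tendsto_pi_nhds]
      intro ω
      rw [Metric.tendsto_nhds]
      intro ε hε
      filter_upwards [hq.mesh (ε / 2) (by positivity)] with h hh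
      have h1 := hr h _ (hW ω j)
      -- Boundedness of `K` matters: `Metric.diam` of an unbounded set is `0` by default.
      have h2 := Metric.dist_le_diam_of_mem (s := {x ∈ K | q h x = q h (W ω j)})
        (hK.subset (Set.sep_subset _ _)) (x := r h (q h (W ω j))) (y := W ω j)
        ⟨h1.1, h1.2⟩ ⟨hW ω j, rfl⟩
      linarith [hh (q h (W ω j))]

end Quantizer

/-! ### The limits in `h` and in `k`. -/

section Limit

variable {d m : ℕ} {Ω : Type*} [MeasurableSpace Ω] {μ : Measure Ω} [IsProbabilityMeasure μ]
  {X : ℤ → Ω → EuclideanSpace ℝ (Fin d)} {Y : Set (EuclideanSpace ℝ (Fin m))}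
  {u c : EuclideanSpace ℝ (Fin m) → EuclideanSpace ℝ (Fin d) → ℝ}

theorem exists_isSaddle_meanLagrangian (hY : IsCompact Y) (hYc : Convex ℝ Y) (hne : Y.Nonempty)
    (hu : IsIntegrand Y u) (hc : IsIntegrand Y c) (γ : ℝ) {L ρ : ℝ} (hL : 0 ≤ L) (hρ : 0 ≤ ρ)
    (P : Measure (EuclideanSpace ℝ (Fin d))) [IsProbabilityMeasure P] :
    ∃ p, IsSaddle Y (Set.Icc 0 L) (meanLagrangian u c γ ρ P) p :=
  exists_isSaddle hY hne hL (hu.convexOn_integral hYc P)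
    ((hc.convexOn_integral hYc P).sub (concaveOn_const γ hYc)) (hu.continuousOn_integral P)
    ((hc.continuousOn_integral P).sub continuousOn_const) hρ

theorem tendsto_meanLagrangian_saddle (hY : IsCompact Y) (hYc : Convex ℝ Y)
    (hu : IsIntegrand Y u) (hc : IsIntegrand Y c) {γ L ρ : ℝ} (hρ : 0 ≤ ρ)
    {P : ℕ → Measure (EuclideanSpace ℝ (Fin d))} {P' : Measure (EuclideanSpace ℝ (Fin d))}
    [IsProbabilityMeasure P'] {r : ℕ → ℝ} (hr : Tendsto r atTop (𝓝 ρ))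
    (hPu : TendstoUniformlyOn (fun n y => ∫ x, u y x ∂(P n)) (fun y => ∫ x, u y x ∂P') atTop Y)
    (hPc : TendstoUniformlyOn (fun n y => ∫ x, c y x ∂(P n)) (fun y => ∫ x, c y x ∂P') atTop Y)
    {p : ℕ → EuclideanSpace ℝ (Fin m) × ℝ} {p' : EuclideanSpace ℝ (Fin m) × ℝ}
    (hp : ∀ n, IsSaddle Y (Set.Icc 0 L) (meanLagrangian u c γ (r n) (P n)) (p n))
    (hp' : IsSaddle Y (Set.Icc 0 L) (meanLagrangian u c γ ρ P') p') :
    Tendsto (fun n => meanLagrangian u c γ 0 (P n) (p n).1 (p n).2) atTop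
      (𝓝 (meanLagrangian u c γ 0 P' p'.1 p'.2)) := by
  have hC' : TendstoUniformlyOn (fun n y => ∫ x, c y x ∂(P n) - γ)
      (fun y => ∫ x, c y x ∂P' - γ) atTop Y := by
    rw [Metric.tendstoUniformlyOn_iff] at hPc ⊢
    simpa only [dist_sub_right] using hPc
  exact tendsto_saddle_value hY hPu hC' hr hρ (hu.convexOn_integral hYc P')
    ((hc.convexOn_integral hYc P').sub (concaveOn_const γ hYc)) (Eventually.of_forall hp) hp'

theorem IsIntegrand.exists_abs_meanLagrangian_le (hu : IsIntegrand Y u) (hc : IsIntegrand Y c)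
    (γ L : ℝ) : ∃ C, ∀ (P : Measure (EuclideanSpace ℝ (Fin d))) [IsProbabilityMeasure P],
      ∀ y ∈ Y, ∀ lam ∈ Set.Icc 0 L, |meanLagrangian u c γ 0 P y lam| ≤ C := by
  obtain ⟨C, hC⟩ := hu.exists_abs_lagLoss_le hc γ L
  refine ⟨C, fun P _ y hy lam hlam => ?_⟩
  rw [← integral_lagLoss hu hc γ P hy]
  simpa using norm_integral_le_of_norm_le_const (μ := P) (f := lagLoss u c γ y lam) (C := C)
    (Eventually.of_forall (hC y hy lam hlam))

theorem exists_isSolution_of_isDualOptimal (hY : IsCompact Y) (hYc : Convex ℝ Y)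
    (hne : Y.Nonempty) (hu : IsIntegrand Y u) (hc : IsIntegrand Y c) {γ L lam : ℝ}
    (P : Measure (EuclideanSpace ℝ (Fin d))) [IsProbabilityMeasure P] (hlam : lam < L)
    (hdual : IsDualOptimal Y u c γ P lam) :
    (∃ y, IsSolution Y u c γ P y) ∧
      ∀ p, IsSaddle Y (Set.Icc 0 L) (meanLagrangian u c γ 0 P) p →
        optValue Y u c γ P = meanLagrangian u c γ 0 P p.1 p.2 := by
  obtain ⟨y, hyY, hgy, hmin, hval⟩ := exists_solution_of_dual_optimal hY hne
    (hu.convexOn_integral hYc P) ((hc.convexOn_integral hYc P).sub (concaveOn_const γ hYc))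
    (hu.continuousOn_integral P) ((hc.continuousOn_integral P).sub continuousOn_const)
    hdual.1 hlam hdual.2
  have hyf : y ∈ feasibleSet Y c γ P := ⟨hyY, sub_nonpos.1 hgy⟩
  have hle : ∀ z ∈ feasibleSet Y c γ P, ∫ x, u y x ∂P ≤ ∫ x, u z x ∂P :=
    fun z hz => hmin z hz.1 (sub_nonpos.2 hz.2)
  refine ⟨⟨y, hyf, hle⟩, fun p hp => ?_⟩
  have hleast : IsLeast ((fun y => ∫ x, u y x ∂P) '' feasibleSet Y c γ P) (∫ x, u y x ∂P) :=
    ⟨⟨y, hyf, rfl⟩, by rintro _ ⟨z, hz, rfl⟩; exact hle z hz⟩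
  rw [optValue, hleast.csInf_eq]
  exact hval p hp

/-- The main theorem for bounded measurable data and a process with values in the cube. -/
theorem limit_of_measurable {D : ℝ} (hY : IsCompact Y) (hYc : Convex ℝ Y) (hne : Y.Nonempty)
    (hu : IsIntegrand Y u) (hc : IsIntegrand Y c) {γ L : ℝ} (hL : 0 ≤ L)
    {y₀ : EuclideanSpace ℝ (Fin m)} {lam₀ : ℝ} {q : ℕ → EuclideanSpace ℝ (Fin d) → ℕ}
    (hq : IsRefiningQuantizer (cube d D) q) (hqm : ∀ h, Measurable (q h))
    (hqf : ∀ h, (Set.range (q h)).Finite) (hD : Bornology.IsBounded (cube d D))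
    {H : ℕ → ℕ → (n : ℕ) → (Fin n → EuclideanSpace ℝ (Fin d)) → EuclideanSpace ℝ (Fin m) × ℝ}
    (hH : ∀ k h, 0 < k → 0 < h → IsHistogramExpert D Y u c γ L y₀ lam₀ q k h (H k h))
    (hX : IsStationaryErgodic μ X) (hXD : ∀ i ω, X i ω ∈ cube d D)
    (hdual : ∀ᵐ ω ∂μ, ∃ lam < L, IsDualOptimal Y u c γ (condPast μ X ω) lam) :
    (∀ᵐ ω ∂μ, ∃ y, IsSolution Y u c γ (condPast μ X ω) y) ∧
      Integrable (fun ω => optValue Y u c γ (condPast μ X ω)) μ ∧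
      ∀ᵐ ω ∂μ, ∃ (a : ℕ → ℕ → ℝ) (b : ℕ → ℝ),
        (∀ k h, 0 < k → 0 < h →
          Tendsto (fun N => avgLoss u c γ (H k h) (fun i => X i ω) N) atTop (𝓝 (a k h))) ∧
        (∀ k, 0 < k → Tendsto (fun h => a k h) atTop (𝓝 (b k))) ∧
        Tendsto b atTop (𝓝 (feasibleOptimum Y u c γ μ X)) := by
  have hXm := hX.measurable
  set ctx : (k : ℕ) → ℕ → Ω → Fin k → ℕ := fun k h ω => context (q h) k fun i => X i ω with hctx
  set Z : (k : ℕ) → Ω → Fin k → EuclideanSpace ℝ (Fin d) :=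
    fun k ω j => X (-(((j : ℕ) : ℤ) + 1)) ω with hZ
  have hctxm : ∀ k h, Measurable (ctx k h) := fun k h =>
    (measurable_context (hqm h) k).comp hX.measurable_path
  have hZm : ∀ k, Measurable (Z k) := fun k => measurable_pi_lambda _ fun j => hXm _
  have hpastm : Measurable (past X) := measurable_pi_lambda _ fun j => hXm _
  have hcond : ∀ ω, IsProbabilityMeasure (condPast μ X ω) := fun ω => by
    unfold condPast; infer_instance
  -- These saddle points are indexed by the discrete context, so functions of them are measurable.
  -- Those for the last `k` observations and the full past are chosen for each `ω` with no
  -- measurability.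
  choose p hp using fun (k h : ℕ) s => exists_isSaddle_meanLagrangian hY hYc hne hu hc γ hL
    (by positivity : (0 : ℝ) ≤ 1 / (h : ℝ) + 1 / (k : ℝ)) (condDistrib (X 0) (ctx k h) μ s)
  choose p' hp' using fun (k : ℕ) ω => exists_isSaddle_meanLagrangian hY hYc hne hu hc γ hL
    (by positivity : (0 : ℝ) ≤ 1 / (k : ℝ)) (condDistrib (X 0) (Z k) μ (Z k ω))
  choose r hr using fun ω => exists_isSaddle_meanLagrangian hY hYc hne hu hc γ hL
    le_rfl (condPast μ X ω)
  obtain ⟨C, hC⟩ := hu.exists_abs_meanLagrangian_le hc γ L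
  set v : ℕ → ℕ → Ω → ℝ := fun k h ω => meanLagrangian u c γ 0
    (condDistrib (X 0) (ctx k h) μ (ctx k h ω)) (p k h (ctx k h ω)).1 (p k h (ctx k h ω)).2 with hv
  set v' : ℕ → Ω → ℝ := fun k ω => meanLagrangian u c γ 0
    (condDistrib (X 0) (Z k) μ (Z k ω)) (p' k ω).1 (p' k ω).2 with hv'
  set w : Ω → ℝ := fun ω => meanLagrangian u c γ 0 (condPast μ X ω) (r ω).1 (r ω).2 with hw
  have hvm : ∀ k h, Measurable (v k h) := fun k h =>
    (Measurable.of_discrete (f := fun s => meanLagrangian u c γ 0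
      (condDistrib (X 0) (ctx k h) μ s) (p k h s).1 (p k h s).2)).comp (hctxm k h)
  have hlim1 : ∀ k, ∀ᵐ ω ∂μ, Tendsto (fun h => v k h ω) atTop (𝓝 (v' k ω)) := by
    intro k
    have hmono := hq.monotone_comap (W := Z k) fun ω j => hXD _ ω
    have hsup := hq.iSup_comap hqm hD (W := Z k) fun ω j => hXD _ ω
    have hrate : Tendsto (fun h : ℕ => 1 / (h : ℝ) + 1 / (k : ℝ)) atTop (𝓝 (1 / (k : ℝ))) := by
      simpa only [zero_add] using tendsto_one_div_atTop_nhds_zero_nat.add_const (1 / (k : ℝ))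
    filter_upwards [hu.ae_tendstoUniformlyOn_condDistrib hY (hctxm k) (hZm k) (hXm 0) hmono hsup,
      hc.ae_tendstoUniformlyOn_condDistrib hY (hctxm k) (hZm k) (hXm 0) hmono hsup] with ω h1 h2
    exact tendsto_meanLagrangian_saddle hY hYc hu hc (by positivity) hrate h1 h2
      (fun h => hp k h _) (hp' k ω)
  have hlim2 : ∀ᵐ ω ∂μ, Tendsto (fun k => v' k ω) atTop (𝓝 (w ω)) := by
    have hmono := monotone_comap_fin fun j : ℕ => X (-((j : ℤ) + 1))
    have hsup := iSup_comap_fin fun j : ℕ => X (-((j : ℤ) + 1))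
    filter_upwards [hu.ae_tendstoUniformlyOn_condDistrib hY hZm hpastm (hXm 0) hmono hsup,
      hc.ae_tendstoUniformlyOn_condDistrib hY hZm hpastm (hXm 0) hmono hsup] with ω h1 h2
    exact tendsto_meanLagrangian_saddle hY hYc hu hc le_rfl
      tendsto_one_div_atTop_nhds_zero_nat h1 h2 (fun k => hp' k ω) (hr ω)
  -- Measurability of the limiting saddle values, and through them of the optimal value, comes from
  -- almost sure convergence, so no measurable selection is required.
  have hv'm : ∀ k, AEStronglyMeasurable (v' k) μ := fun k =>
    aestronglyMeasurable_of_tendsto_ae atTop (fun h => (hvm k h).aestronglyMeasurable) (hlim1 k)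
  have hwm : AEStronglyMeasurable w μ := aestronglyMeasurable_of_tendsto_ae atTop hv'm hlim2
  have hopt : ∀ᵐ ω ∂μ, (∃ y, IsSolution Y u c γ (condPast μ X ω) y) ∧
      optValue Y u c γ (condPast μ X ω) = w ω := by
    filter_upwards [hdual] with ω ⟨lam, hlam, hdual⟩
    have := exists_isSolution_of_isDualOptimal hY hYc hne hu hc (condPast μ X ω) hlam hdual
    exact ⟨this.1, this.2 _ (hr ω)⟩
  have hwint : Integrable w μ := Integrable.of_bound hwm C
    (Eventually.of_forall fun ω => hC _ _ (hr ω).1 _ (hr ω).2.1)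
  have hopt' : (fun ω => optValue Y u c γ (condPast μ X ω)) =ᵐ[μ] w := hopt.mono fun ω h => h.2
  refine ⟨hopt.mono fun ω h => h.1, hwint.congr hopt'.symm, ?_⟩
  have hexp : ∀ k h, 0 < k → 0 < h → ∀ᵐ ω ∂μ,
      Tendsto (avgLoss u c γ (H k h) fun i => X i ω) atTop (𝓝 (∫ ω, v k h ω ∂μ)) := by
    intro k h hk hh
    have h1 := (hH k h hk hh).ae_tendsto_avgLoss hY hYc hne hu hc hL hk (hqm h) (hqf h) hX hXD
      (hp k h)
    rwa [integral_lagLoss_context hu hc (fun s => (hp k h s).1) (fun s => (hp k h s).2.1)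
      (hctxm k h) (hXm 0)] at h1
  have hall : ∀ᵐ ω ∂μ, ∀ k h, 0 < k → 0 < h →
      Tendsto (avgLoss u c γ (H k h) fun i => X i ω) atTop (𝓝 (∫ ω, v k h ω ∂μ)) := by
    simp only [ae_all_iff]
    exact hexp
  filter_upwards [hall] with ω hω
  refine ⟨fun k h => ∫ ω, v k h ω ∂μ, fun k => ∫ ω, v' k ω ∂μ, hω, fun k _ => ?_, ?_⟩
  · exact tendsto_integral_of_dominated_convergence (fun _ => C)
      (fun h => (hvm k h).aestronglyMeasurable) (integrable_const C)
      (fun h => Eventually.of_forall fun ω => hC _ _ (hp k h _).1 _ (hp k h _).2.1) (hlim1 k)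
  · rw [feasibleOptimum, integral_congr_ae hopt']
    exact tendsto_integral_of_dominated_convergence (fun _ => C) hv'm (integrable_const C)
      (fun k => Eventually.of_forall fun ω => hC _ _ (hp' k _).1 _ (hp' k _).2.1) hlim2

end Limit

/-! ### Projection onto the cube and dyadic quantizers. -/

section Cube

variable {d m : ℕ}

/-- The coordinatewise projection onto the cube. -/
noncomputable def clamp (D : ℝ) (x : EuclideanSpace ℝ (Fin d)) : EuclideanSpace ℝ (Fin d) :=
  WithLp.toLp 2 fun i => max (-D) (min D (x i))

theorem continuous_clamp (D : ℝ) : Continuous (clamp D : EuclideanSpace ℝ (Fin d) → _) := by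
  unfold clamp
  fun_prop

theorem clamp_mem_cube {D : ℝ} (hD : 0 ≤ D) (x : EuclideanSpace ℝ (Fin d)) :
    clamp D x ∈ cube d D := fun i => by
  simp only [clamp]
  rw [abs_le]
  exact ⟨le_max_left _ _, max_le (by linarith) (min_le_left _ _)⟩

theorem clamp_of_mem_cube {D : ℝ} {x : EuclideanSpace ℝ (Fin d)} (hx : x ∈ cube d D) :
    clamp D x = x := by
  ext i
  have := abs_le.1 (hx i)
  simp only [clamp]
  rw [min_eq_right this.2, max_eq_right this.1]

theorem isCompact_cube (d : ℕ) (D : ℝ) : IsCompact (cube d D) := by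
  have h1 : IsCompact (Set.univ.pi fun _ : Fin d => Set.Icc (-D) D) :=
    isCompact_univ_pi fun _ => isCompact_Icc
  have h2 := (PiLp.continuousLinearEquiv 2 ℝ fun _ : Fin d => ℝ).toHomeomorph.isCompact_preimage.2
    h1
  convert h2 using 1
  ext x
  simp [cube, abs_le, Pi.le_def, forall_and]

theorem measurableSet_cube (d : ℕ) (D : ℝ) : MeasurableSet (cube d D) :=
  (isCompact_cube d D).isClosed.measurableSet

/-- The data are controlled only on `Y ×ˢ cube d D`, which is compact. Clamping extends them to all
`x`, with the bound and the modulus given there by compactness. -/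
theorem isIntegrand_clamp {D : ℝ} (hD : 0 ≤ D) {Y : Set (EuclideanSpace ℝ (Fin m))}
    (hY : IsCompact Y) {u : EuclideanSpace ℝ (Fin m) → EuclideanSpace ℝ (Fin d) → ℝ}
    (hu : ContinuousOn (Function.uncurry u) (Y ×ˢ cube d D))
    (hconv : ∀ x ∈ cube d D, ConvexOn ℝ Y fun y => u y x) :
    IsIntegrand Y fun y x => u y (clamp D x) where
  measurable y hy := by
    refine Continuous.measurable ?_
    rw [← continuousOn_univ]
    exact hu.comp (f := fun x => (y, clamp D x))
      (continuous_const.prodMk (continuous_clamp D)).continuousOn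
      fun x _ => ⟨hy, clamp_mem_cube hD x⟩
  bounded := by
    obtain ⟨C, hC⟩ := (hY.prod (isCompact_cube d D)).exists_bound_of_continuousOn hu
    exact ⟨C, fun y hy x => hC (y, clamp D x) ⟨hy, clamp_mem_cube hD x⟩⟩
  equicont := by
    intro ε hε
    have h1 := (hY.prod (isCompact_cube d D)).uniformContinuousOn_of_continuous hu
    obtain ⟨δ, hδ, h⟩ := Metric.uniformContinuousOn_iff.1 h1 ε hε
    refine ⟨δ, hδ, fun y hy z hz hyz x => ?_⟩
    have h2 := h (y, clamp D x) ⟨hy, clamp_mem_cube hD x⟩ (z, clamp D x)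
      ⟨hz, clamp_mem_cube hD x⟩ (by rw [Prod.dist_eq, dist_self]; exact max_lt hyz hδ)
    exact h2.le
  convex x := hconv _ (clamp_mem_cube hD x)

/-- Dyadic cubes of side `2⁻ʰ` work: halving a fine integer label and rounding down gives the coarse
one, and squared diameters are at most `d * 4⁻ʰ`. -/
theorem exists_isRefiningQuantizer (d : ℕ) (D : ℝ) : ∃ q, IsRefiningQuantizer (cube d D) q := by
  set cell : ℕ → EuclideanSpace ℝ (Fin d) → Fin d → ℤ := fun h x i => ⌊x i * 2 ^ h⌋ with hcell
  refine ⟨fun h x => Encodable.encode (cell h x), ?_, ?_, ?_, ?_⟩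
  · intro h j
    have h1 : Measurable (cell h) := measurable_pi_lambda _ fun i => by
      have : Measurable fun x : EuclideanSpace ℝ (Fin d) => x i * 2 ^ h := by fun_prop
      exact this.floor
    have h2 : Measurable fun x => Encodable.encode (cell h x) :=
      (Measurable.of_discrete (f := Encodable.encode (α := Fin d → ℤ))).comp h1
    exact (measurableSet_cube d D).inter (h2 (measurableSet_singleton j))
  · intro h
    have h1 : (cell h '' cube d D).Finite := by
      refine (Set.Finite.pi' (t := fun _ : Fin d => Set.Icc ⌊-D * 2 ^ h⌋ ⌊D * 2 ^ h⌋)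
        fun _ => Set.finite_Icc _ _).subset ?_
      rintro _ ⟨x, hx, rfl⟩ i
      have := abs_le.1 (hx i)
      exact ⟨Int.floor_le_floor (mul_le_mul_of_nonneg_right this.1 (by positivity)),
        Int.floor_le_floor (mul_le_mul_of_nonneg_right this.2 (by positivity))⟩
    have h2 := h1.image Encodable.encode
    rwa [Set.image_image] at h2
  · intro h x _ y _ hxy
    have h1 : cell (h + 1) x = cell (h + 1) y := Encodable.encode_injective hxy
    have h2 : ∀ z : EuclideanSpace ℝ (Fin d), ∀ i, cell h z i = cell (h + 1) z i / 2 := by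
      intro z i
      have h3 := Int.floor_div_natCast (z i * 2 ^ (h + 1)) 2
      simp only [hcell]
      rw [show z i * 2 ^ h = z i * 2 ^ (h + 1) / ((2 : ℕ) : ℝ) by push_cast; ring, h3]
      rfl
    have h3 : cell h x = cell h y := by
      funext i
      rw [h2, h2, h1]
    simp only [h3]
  · intro ε hε
    have hlim : Tendsto (fun h : ℕ => (d : ℝ) * ((1 / 2 : ℝ) ^ h) ^ 2) atTop (𝓝 0) := by
      have := ((tendsto_pow_atTop_nhds_zero_of_lt_one (by norm_num : (0 : ℝ) ≤ 1 / 2)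
        (by norm_num)).pow 2).const_mul (d : ℝ)
      simpa using this
    filter_upwards [hlim.eventually_le_const (by positivity : (0 : ℝ) < ε ^ 2)] with h hh j
    refine Metric.diam_le_of_forall_dist_le hε.le fun x hx y hy => ?_
    have h1 : cell h x = cell h y := Encodable.encode_injective (hx.2.trans hy.2.symm)
    rw [EuclideanSpace.dist_eq]
    refine Real.sqrt_le_iff.2 ⟨hε.le, le_trans ?_ hh⟩
    have h2 : ∀ i, dist (x i) (y i) ^ 2 ≤ ((1 / 2 : ℝ) ^ h) ^ 2 := by
      intro i
      refine pow_le_pow_left₀ dist_nonneg ?_ 2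
      have h3 := (Int.abs_sub_lt_one_of_floor_eq_floor (congrFun h1 i)).le
      rw [← sub_mul, abs_mul, abs_of_pos (by positivity : (0 : ℝ) < 2 ^ h)] at h3
      rw [Real.dist_eq, one_div, inv_pow, ← one_div, le_div_iff₀ (by positivity)]
      exact h3
    refine (Finset.sum_le_sum fun i _ => h2 i).trans ?_
    simp

end Cube

/-! ### Clamped data, and existence of the experts. -/

section Reduction

variable {d m : ℕ} {D : ℝ} {Y : Set (EuclideanSpace ℝ (Fin m))}
  {u c : EuclideanSpace ℝ (Fin m) → EuclideanSpace ℝ (Fin d) → ℝ}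
  {q : ℕ → EuclideanSpace ℝ (Fin d) → ℕ}

theorem IsRefiningQuantizer.clamp (hq : IsRefiningQuantizer (cube d D) q) :
    IsRefiningQuantizer (cube d D) fun h x => q h (clamp D x) := by
  have hcell : ∀ h j, {x ∈ cube d D | q h (HistogramExperts.clamp D x) = j}
      = {x ∈ cube d D | q h x = j} := by
    intro h j
    ext x
    refine and_congr_right fun hx => ?_
    rw [clamp_of_mem_cube hx]
  refine ⟨fun h j => ?_, fun h => ?_, fun h x hx y hy => ?_, fun ε hε => ?_⟩
  · rw [hcell]; exact hq.measurable_cell h j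
  · have : (fun x => q h (HistogramExperts.clamp D x)) '' cube d D = q h '' cube d D :=
      Set.image_congr fun x hx => by rw [clamp_of_mem_cube hx]
    rw [this]
    exact hq.finite_cells h
  · rw [clamp_of_mem_cube hx, clamp_of_mem_cube hy]
    exact hq.refines h x hx y hy
  · simpa only [hcell] using hq.mesh ε hε

theorem IsRefiningQuantizer.measurable_clamp (hD : 0 ≤ D)
    (hq : IsRefiningQuantizer (cube d D) q) (h : ℕ) :
    Measurable fun x => q h (HistogramExperts.clamp D x) := by
  refine measurable_to_countable' fun j => ?_
  have := (continuous_clamp D).measurable (hq.measurable_cell h j)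
  convert this using 1
  ext x
  exact ⟨fun hx => ⟨clamp_mem_cube hD x, hx⟩, fun hx => hx.2⟩

theorem IsRefiningQuantizer.finite_range_clamp (hD : 0 ≤ D)
    (hq : IsRefiningQuantizer (cube d D) q) (h : ℕ) :
    (Set.range fun x => q h (HistogramExperts.clamp D x)).Finite := by
  refine (hq.finite_cells h).subset ?_
  rintro _ ⟨x, rfl⟩
  exact ⟨_, clamp_mem_cube hD x, rfl⟩

theorem matchingTimes_clamp (k h : ℕ) {n : ℕ} {x : Fin n → EuclideanSpace ℝ (Fin d)}
    (hx : ∀ i, x i ∈ cube d D) :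
    matchingTimes (fun z => q h (clamp D z)) k x = matchingTimes (q h) k x := by
  simp only [matchingTimes, clamp_of_mem_cube (hx _)]

theorem empLoss_clamp (γ : ℝ) (k h : ℕ) {n : ℕ} {x : Fin n → EuclideanSpace ℝ (Fin d)}
    (hx : ∀ i, x i ∈ cube d D) :
    empLoss (fun y z => u y (clamp D z)) (fun y z => c y (clamp D z)) γ
      (fun h z => q h (clamp D z)) k h x = empLoss u c γ q k h x := by
  funext y lam
  simp only [empLoss, matchingTimes_clamp k h hx, regLoss, lagLoss, clamp_of_mem_cube (hx _)]

theorem IsHistogramExpert.clamp {γ L : ℝ} {y₀ : EuclideanSpace ℝ (Fin m)} {lam₀ : ℝ} {k h : ℕ}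
    {G : (n : ℕ) → (Fin n → EuclideanSpace ℝ (Fin d)) → EuclideanSpace ℝ (Fin m) × ℝ}
    (hG : IsHistogramExpert D Y u c γ L y₀ lam₀ q k h G) :
    IsHistogramExpert D Y (fun y z => u y (HistogramExperts.clamp D z))
      (fun y z => c y (HistogramExperts.clamp D z)) γ L y₀ lam₀
      (fun h z => q h (HistogramExperts.clamp D z)) k h G := by
  intro n x hx
  rw [matchingTimes_clamp k h hx, empLoss_clamp γ k h hx]
  exact hG n x hx

theorem exists_isMinimaxPair_empLoss (hY : IsCompact Y) (hYc : Convex ℝ Y)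
    (hne : Y.Nonempty)
    (hu : IsIntegrand Y fun y x => u y (clamp D x)) (hc : IsIntegrand Y fun y x => c y (clamp D x))
    (γ : ℝ) {L : ℝ} (hL : 0 ≤ L) (k h : ℕ) {n : ℕ} {x : Fin n → EuclideanSpace ℝ (Fin d)}
    (hx : ∀ i, x i ∈ cube d D) (hm : matchingTimes (q h) k x ≠ ∅) :
    ∃ p, IsMinimaxPair Y (Set.Icc 0 L) (empLoss u c γ q k h x) p := by
  rw [← empLoss_clamp γ k h hx]
  rw [← matchingTimes_clamp k h hx] at hm
  -- The finite history is embedded in a two-sided path, slot `j` at time `j + 1`, to reuse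
  -- `empLoss_eq_saddleFun`; other times are irrelevant.
  set x' : ℤ → EuclideanSpace ℝ (Fin d) := fun i =>
    if hi : (i - 1).toNat < n then x ⟨(i - 1).toNat, hi⟩ else 0 with hx'
  have hxx : x = fun j : Fin n => x' ((j : ℕ) + 1) := by
    funext j
    simp [hx']
  rw [hxx] at hm ⊢
  rw [empLoss_eq_saddleFun (fun y z => u y (clamp D z)) (fun y z => c y (clamp D z)) γ
    (fun h z => q h (clamp D z)) k h n x' hm]
  have hf := hu.convexOn_contextMean hYc (fun z => q h (clamp D z)) k x'
    (context (fun z => q h (clamp D z)) k (shiftPath (n + 1) x')) n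
  have hg := (hc.convexOn_contextMean hYc (fun z => q h (clamp D z)) k x'
    (context (fun z => q h (clamp D z)) k (shiftPath (n + 1) x')) n).sub (concaveOn_const γ hYc)
  have hfc := (hu.equicont_contextMean (fun z => q h (clamp D z)) k x'
    (context (fun z => q h (clamp D z)) k (shiftPath (n + 1) x'))).continuousOn n
  have hgc := ((hc.equicont_contextMean (fun z => q h (clamp D z)) k x'
    (context (fun z => q h (clamp D z)) k (shiftPath (n + 1) x'))).continuousOn n).sub
      (continuousOn_const (c := γ))
  have hρ : (0 : ℝ) ≤ 1 / ((n + 1 : ℕ) : ℝ) + 1 / (h : ℝ) + 1 / (k : ℝ) := by positivity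
  obtain ⟨p, hp⟩ := exists_isSaddle hY hne hL hf hg hfc hgc hρ
  exact ⟨p, (isMinimaxPair_saddleFun_iff hY hne hL hf hg hfc hgc hρ).2 hp⟩

theorem exists_isHistogramExpert (hY : IsCompact Y) (hYc : Convex ℝ Y)
    (hne : Y.Nonempty)
    (hu : IsIntegrand Y fun y x => u y (clamp D x)) (hc : IsIntegrand Y fun y x => c y (clamp D x))
    (γ : ℝ) {L : ℝ} (hL : 0 ≤ L) (y₀ : EuclideanSpace ℝ (Fin m)) (lam₀ : ℝ)
    (q : ℕ → EuclideanSpace ℝ (Fin d) → ℕ) (k h : ℕ) :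
    ∃ G, IsHistogramExpert D Y u c γ L y₀ lam₀ q k h G := by
  have key : ∀ (n : ℕ) (x : Fin n → EuclideanSpace ℝ (Fin d)), ∃ p : EuclideanSpace ℝ (Fin m) × ℝ,
      (∀ i, x i ∈ cube d D) → (matchingTimes (q h) k x = ∅ → p = (y₀, lam₀)) ∧
        (matchingTimes (q h) k x ≠ ∅ →
          IsMinimaxPair Y (Set.Icc 0 L) (empLoss u c γ q k h x) p) := by
    intro n x
    by_cases hx : ∀ i, x i ∈ cube d D
    · by_cases hm : matchingTimes (q h) k x = ∅
      · exact ⟨(y₀, lam₀), fun _ => ⟨fun _ => rfl, fun h => absurd hm h⟩⟩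
      · obtain ⟨p, hp⟩ := exists_isMinimaxPair_empLoss hY hYc hne hu hc γ hL k h hx hm
        exact ⟨p, fun _ => ⟨fun h => absurd h hm, fun _ => hp⟩⟩
    · exact ⟨(y₀, lam₀), fun h => absurd h hx⟩
  choose G hG using key
  exact ⟨G, hG⟩

end Reduction

/-! ### Transfer between a process and its clamped version. -/

section ReductionProcess

variable {d m : ℕ} {D : ℝ} {Y : Set (EuclideanSpace ℝ (Fin m))}
  {u c : EuclideanSpace ℝ (Fin m) → EuclideanSpace ℝ (Fin d) → ℝ}
  {Ω : Type*} [MeasurableSpace Ω] {μ : Measure Ω} {X : ℤ → Ω → EuclideanSpace ℝ (Fin d)}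

/-- The joint law of past and present disintegrates into the conditional laws, so an almost sure
property of `X 0` holds under almost every one of them. -/
theorem ae_condPast_mem [IsFiniteMeasure μ] (hX : ∀ i, Measurable (X i))
    (hXD : ∀ᵐ ω ∂μ, X 0 ω ∈ cube d D) :
    ∀ᵐ ω ∂μ, ∀ᵐ x ∂(condPast μ X ω), x ∈ cube d D := by
  have hp : Measurable (past X) := measurable_pi_lambda _ fun j => hX _
  have h1 : ∀ᵐ z ∂(μ.map fun ω => (past X ω, X 0 ω)), z.2 ∈ cube d D := by
    rw [ae_map_iff (hp.prodMk (hX 0)).aemeasurable (measurable_snd (measurableSet_cube d D))]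
    exact hXD
  rw [← compProd_map_condDistrib (hX 0).aemeasurable] at h1
  exact ae_of_ae_map hp.aemeasurable (Measure.ae_ae_of_ae_compProd h1)

theorem IsStationaryErgodic.congr (hX : IsStationaryErgodic μ X)
    {X' : ℤ → Ω → EuclideanSpace ℝ (Fin d)} (hX' : ∀ i, Measurable (X' i))
    (h : ∀ᵐ ω ∂μ, ∀ i, X' i ω = X i ω) : IsStationaryErgodic μ X' := by
  refine ⟨hX', ?_⟩
  have : μ.map (fun ω i => X' i ω) = μ.map fun ω i => X i ω :=
    Measure.map_congr (h.mono fun ω hω => funext hω)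
  rw [this]
  exact hX.ergodic

theorem ae_condPast_congr [IsFiniteMeasure μ] {X' : ℤ → Ω → EuclideanSpace ℝ (Fin d)}
    (h : ∀ᵐ ω ∂μ, ∀ i, X' i ω = X i ω) : ∀ᵐ ω ∂μ, condPast μ X' ω = condPast μ X ω := by
  have h1 : past X' =ᵐ[μ] past X := h.mono fun ω hω => funext fun j => hω _
  filter_upwards [h1] with ω hω
  rw [condPast, condPast, condDistrib_congr (h.mono fun ω hω => hω 0) h1, hω]

theorem integral_clamp {P : Measure (EuclideanSpace ℝ (Fin d))} (hP : ∀ᵐ x ∂P, x ∈ cube d D)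
    (f : EuclideanSpace ℝ (Fin d) → ℝ) : ∫ x, f (clamp D x) ∂P = ∫ x, f x ∂P :=
  integral_congr_ae (hP.mono fun x hx => by simp only [clamp_of_mem_cube hx])

theorem avgLoss_clamp (γ : ℝ)
    (G : (n : ℕ) → (Fin n → EuclideanSpace ℝ (Fin d)) → EuclideanSpace ℝ (Fin m) × ℝ)
    {x : ℤ → EuclideanSpace ℝ (Fin d)} (hx : ∀ i, x i ∈ cube d D) (N : ℕ) :
    avgLoss (fun y z => u y (clamp D z)) (fun y z => c y (clamp D z)) γ G x N
      = avgLoss u c γ G x N := by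
  simp only [avgLoss, lagLoss, clamp_of_mem_cube (hx _)]

theorem isDualOptimal_clamp {P : Measure (EuclideanSpace ℝ (Fin d))}
    (hP : ∀ᵐ x ∂P, x ∈ cube d D) (γ lam : ℝ) :
    IsDualOptimal Y (fun y z => u y (clamp D z)) (fun y z => c y (clamp D z)) γ P lam
      ↔ IsDualOptimal Y u c γ P lam := by
  simp only [IsDualOptimal, fun y => integral_clamp hP (u y), fun y => integral_clamp hP (c y)]

theorem feasibleSet_clamp {P : Measure (EuclideanSpace ℝ (Fin d))}
    (hP : ∀ᵐ x ∂P, x ∈ cube d D) (γ : ℝ) :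
    feasibleSet Y (fun y z => c y (clamp D z)) γ P = feasibleSet Y c γ P := by
  simp only [feasibleSet, fun y => integral_clamp hP (c y)]

theorem isSolution_clamp {P : Measure (EuclideanSpace ℝ (Fin d))}
    (hP : ∀ᵐ x ∂P, x ∈ cube d D) (γ : ℝ) (y : EuclideanSpace ℝ (Fin m)) :
    IsSolution Y (fun y z => u y (clamp D z)) (fun y z => c y (clamp D z)) γ P y
      ↔ IsSolution Y u c γ P y := by
  simp only [IsSolution, feasibleSet_clamp hP, fun y => integral_clamp hP (u y)]

theorem optValue_clamp {P : Measure (EuclideanSpace ℝ (Fin d))}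
    (hP : ∀ᵐ x ∂P, x ∈ cube d D) (γ : ℝ) :
    optValue Y (fun y z => u y (clamp D z)) (fun y z => c y (clamp D z)) γ P
      = optValue Y u c γ P := by
  simp only [optValue, feasibleSet_clamp hP, fun y => integral_clamp hP (u y)]

end ReductionProcess

end HistogramExperts

theorem theorem2 {d m : ℕ} (D : ℝ) (hD : 0 < D)
    (Y : Set (EuclideanSpace ℝ (Fin m))) (hYcompact : IsCompact Y) (hYconvex : Convex ℝ Y)
    (u c : EuclideanSpace ℝ (Fin m) → EuclideanSpace ℝ (Fin d) → ℝ)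
    (hu : ContinuousOn (Function.uncurry u) (Y ×ˢ cube d D))
    (hc : ContinuousOn (Function.uncurry c) (Y ×ˢ cube d D))
    (hu_convex : ∀ x ∈ cube d D, ConvexOn ℝ Y fun y => u y x)
    (hc_convex : ∀ x ∈ cube d D, ConvexOn ℝ Y fun y => c y x)
    (γ : ℝ) (hγ : 0 < γ) (lamMax : ℝ) (hlamMax : 0 < lamMax)
    (y₀ : EuclideanSpace ℝ (Fin m)) (hy₀ : y₀ ∈ Y) (lam₀ : ℝ) (hlam₀ : lam₀ ∈ Set.Icc 0 lamMax) :
    (∃ q, IsRefiningQuantizer (cube d D) q) ∧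
    ∀ q, IsRefiningQuantizer (cube d D) q →
      (∃ H : ℕ → ℕ → (n : ℕ) → (Fin n → EuclideanSpace ℝ (Fin d)) → EuclideanSpace ℝ (Fin m) × ℝ,
        ∀ k h, 0 < k → 0 < h → IsHistogramExpert D Y u c γ lamMax y₀ lam₀ q k h (H k h)) ∧
      ∀ H : ℕ → ℕ → (n : ℕ) → (Fin n → EuclideanSpace ℝ (Fin d)) → EuclideanSpace ℝ (Fin m) × ℝ,
        (∀ k h, 0 < k → 0 < h → IsHistogramExpert D Y u c γ lamMax y₀ lam₀ q k h (H k h)) →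
        ∀ (Ω : Type*) [MeasurableSpace Ω] (μ : Measure Ω) [IsProbabilityMeasure μ]
          (X : ℤ → Ω → EuclideanSpace ℝ (Fin d)),
          IsFeasibleProcess D Y c γ μ X →
          (∀ᵐ ω ∂μ, ∃ lam < lamMax, IsDualOptimal Y u c γ (condPast μ X ω) lam) →
          (∀ᵐ ω ∂μ, ∃ y, IsSolution Y u c γ (condPast μ X ω) y) ∧
          Integrable (fun ω => optValue Y u c γ (condPast μ X ω)) μ ∧
          ∀ᵐ ω ∂μ, ∃ (a : ℕ → ℕ → ℝ) (b : ℕ → ℝ),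
            (∀ k h, 0 < k → 0 < h →
              Tendsto (fun N => avgLoss u c γ (H k h) (fun i => X i ω) N) atTop (𝓝 (a k h))) ∧
            (∀ k, 0 < k → Tendsto (fun h => a k h) atTop (𝓝 (b k))) ∧
            Tendsto b atTop (𝓝 (feasibleOptimum Y u c γ μ X)) := by

  have hD0 : 0 ≤ D := hD.le
  have hne : Y.Nonempty := ⟨y₀, hy₀⟩
  have hu' := isIntegrand_clamp hD0 hYcompact hu hu_convex
  have hc' := isIntegrand_clamp hD0 hYcompact hc hc_convex
  refine ⟨exists_isRefiningQuantizer d D, fun q hq => ⟨?_, ?_⟩⟩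
  · choose H hH using fun k h => exists_isHistogramExpert hYcompact hYconvex hne hu' hc' γ
      hlamMax.le y₀ lam₀ q k h
    exact ⟨H, fun k h _ _ => hH k h⟩
  intro H hH Ω _ μ _ X hX hdual
  have hXm := hX.stationaryErgodic.measurable
  have hmem : ∀ᵐ ω ∂μ, ∀ i, X i ω ∈ cube d D := ae_all_iff.2 hX.mem_cube
  -- This modification lies in the cube for every `ω`, as `limit_of_measurable` demands. It agrees
  -- almost surely with `X` at all times at once, so path law and conditional laws are unchanged up
  -- to null sets.
  set X' : ℤ → Ω → EuclideanSpace ℝ (Fin d) := fun i ω => clamp D (X i ω) with hX'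
  have hXX' : ∀ᵐ ω ∂μ, ∀ i, X' i ω = X i ω := hmem.mono fun ω h i => clamp_of_mem_cube (h i)
  have hX'm : ∀ i, Measurable (X' i) := fun i => (continuous_clamp D).measurable.comp (hXm i)
  have hcond := ae_condPast_congr hXX'
  have hsupp := ae_condPast_mem hXm (hX.mem_cube 0)
  obtain ⟨hsol, hint, hlim⟩ := limit_of_measurable (X := X') hYcompact hYconvex hne hu' hc'
    hlamMax.le hq.clamp (hq.measurable_clamp hD0) (hq.finite_range_clamp hD0)
    (isCompact_cube d D).isBounded (fun k h hk hh => (hH k h hk hh).clamp)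
    (hX.stationaryErgodic.congr hX'm hXX') (fun i ω => clamp_mem_cube hD0 _) (by
      filter_upwards [hdual, hcond, hsupp] with ω ⟨lam, hlam, h⟩ h1 h2
      rw [h1]
      exact ⟨lam, hlam, (isDualOptimal_clamp h2 γ lam).2 h⟩)
  have hopt : (fun ω => optValue Y (fun y z => u y (clamp D z)) (fun y z => c y (clamp D z)) γ
      (condPast μ X' ω)) =ᵐ[μ] fun ω => optValue Y u c γ (condPast μ X ω) := by
    filter_upwards [hcond, hsupp] with ω h1 h2
    rw [h1, optValue_clamp h2]
  refine ⟨?_, hint.congr hopt, ?_⟩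
  · filter_upwards [hsol, hcond, hsupp] with ω ⟨y, hy⟩ h1 h2
    rw [h1] at hy
    exact ⟨y, (isSolution_clamp h2 γ y).1 hy⟩
  · filter_upwards [hlim, hXX', hmem] with ω ⟨a, b, h1, h2, h3⟩ h4 h5
    refine ⟨a, b, fun k h hk hh => ?_, h2, ?_⟩
    · have h6 := h1 k h hk hh
      simp only [h4] at h6
      simpa only [avgLoss_clamp γ (H k h) h5] using h6
    · rwa [feasibleOptimum, integral_congr_ae hopt] at h3
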